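/- For $\beta>0$ and $r\in\mathbb C$ put $q=e^{-\beta/2}$ and $$V(r)=\sum_{m\in\mathbb Z}\frac{1}{4\sin^2[(r+i\beta m)/2]},\qquad \theta(r)=\sin(r/2)\prod_{m=1}^\infty\bigl(1-2q^{2m}\cos r+q^{4m}\bigr),$$ $$c_1=\frac1{12},\qquad c_0=c_1-\sum_{m=1}^\infty\frac1{2\sinh^2(\beta m/2)}.$$ Let $N,\tilde N,M,\tilde M$ be non-negative integers and $\lambda\in\mathbb C\setminus\{0\}$. Let $$H_{N,\tilde N}(\mathbf x,\tilde{\mathbf x})=-\sum_{j=1}^N\frac{\partial^2}{\partial x_j^2}+\sum_{1\le j<k\le N}2\lambda(\lambda-1)V(x_j-x_k)+\lambda\sum_{J=1}^{\tilde N}\frac{\partial^2}{\partial\tilde x_J^2}+\sum_{1\le J<K\le\tilde N}\frac{2(\lambda-1)}{\lambda}V(\tilde x_J-\tilde x_K)+\sum_{j=1}^N\sum_{K=1}^{\tilde N}2(1-\lambda)V(x_j-\tilde x_K),$$ $$\Psi_0^{N,\tilde N}(\mathbf x,\tilde{\mathbf x})=\frac{\prod_{j<k}\theta(x_j-x_k)^\lambda\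 \prod_{J<K}\theta(\tilde x_J-\tilde x_K)^{1/\lambda}}{\prod_{j=1}^N\prod_{J=1}^{\tilde N}\theta(x_j-\tilde x_J)},$$ $$F(\mathbf x,\tilde{\mathbf x},\mathbf y,\tilde{\mathbf y})=\Psi_0^{N,\tilde N}(\mathbf x,\tilde{\mathbf x})\,\Psi_0^{M,\tilde M}(\mathbf y,\tilde{\mathbf y})\,\frac{\prod_{j=1}^N\prod_{K=1}^{\tilde M}\theta(x_j-\tilde y_K)\ \prod_{J=1}^{\tilde N}\prod_{k=1}^M\theta(\tilde x_J-y_k)}{\prod_{j=1}^N\prod_{k=1}^M\theta(x_j-y_k)^\lambda\ \prod_{J=1}^{\tilde N}\prod_{K=1}^{\tilde M}\theta(\tilde x_J-\tilde y_K)^{1/\lambda}},$$ and $$\begin{aligned}C={}&\Bigl([N(N-1)-M(M-1)]\lambda^2-(N+M)(\tilde N-\tilde M)\lambda+(N-M)(\tilde N+\tilde M)-[\tilde N(\tilde N-1)-\tilde M(\tilde M-1)]/\lambda\Bigr)c_0\\&+\Bigl((N-M)[(N-M)^2-N-M]\lambda^2-[3(N-M)^2-N-M](\tilde N-\tilde M)\lambda\\&\qquad+(N-M)[3(\tilde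 N-\tilde M)^2-\tilde N-\tilde M]-(\tilde N-\tilde M)[(\tilde N-\tilde M)^2-\tilde N-\tilde M]/\lambda\Bigr)c_1.\end{aligned}$$ Here the variables are complex and $\theta^s=\exp(s\log\theta)$, where $\log\theta$ is any continuous branch, as a function of $(r,\beta)$, on an open subset $D$ of $\mathbb C\times(0,\infty)$. For $v\in\mathbb R$ and $c\in\mathbb C\setminus\{0\}$ put $$G(\mathbf x,\tilde{\mathbf x},\mathbf y,\tilde{\mathbf y})=c\,F(\mathbf x,\tilde{\mathbf x},\mathbf y,\tilde{\mathbf y})\,\exp\bigl(iv[|\mathbf x|-|\mathbf y|-(|\tilde{\mathbf x}|-|\tilde{\mathbf y}|)/\lambda]\bigr),\qquad |\mathbf x|:=\sum_{j}x_j\ \text{ etc.}$$ Then, at every point where the arguments of all powers $\theta^{\pm\lambda},\theta^{\pm1/\lambda}$ in $F$ (together with $\beta$) lie in $D$ and no $\theta(x_j-\tilde x_K)$ and no $\theta(y_j-\tilde y_K)$ vanishes, $G$ is analytic in $(\mathbf x,\tilde{\mathbf x},\mathbf y,\tilde{\mathbf y})$ and differentiable in $\beta$, and $$\Bigl(H_{N,\tilde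 N}(\mathbf x,\tilde{\mathbf x})-H_{M,\tilde M}(\mathbf y,\tilde{\mathbf y})+2[(N-M)\lambda-\tilde N+\tilde M]\frac{\partial}{\partial\beta}-C-[N-M-(\tilde N-\tilde M)/\lambda]v^2\Bigr)G=0.$$ -/

import Mathlib

noncomputable section

namespace EllipticCS

/-- The potential `V(r) = ∑_{m ∈ ℤ} 1 / (4 sin²((r + iβm)/2))`, with periods `2π` and `iβ`. -/
def V (β : ℝ) (r : ℂ) : ℂ :=
  ∑' m : ℤ, 1 / (4 * Complex.sin ((r + Complex.I * (β : ℂ) * (m : ℂ)) / 2) ^ 2)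

/-- The nome `q = exp(-β/2)`. -/
def nome (β : ℝ) : ℝ := Real.exp (-β / 2)

/-- `θ(r) = sin(r/2) ∏_{m ≥ 1} (1 - 2 q^{2m} cos r + q^{4m})`. -/
def theta (β : ℝ) (r : ℂ) : ℂ :=
  Complex.sin (r / 2) *
    ∏' m : ℕ, (1 - 2 * (nome β : ℂ) ^ (2 * (m + 1)) * Complex.cos r
      + (nome β : ℂ) ^ (4 * (m + 1)))

/-- `c₁ = 1/12`. -/
def c1 : ℝ := 1 / 12

/-- `c₀ = c₁ - ∑_{m ≥ 1} 1 / (2 sinh²(βm/2))`. -/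
def c0 (β : ℝ) : ℝ :=
  c1 - ∑' m : ℕ, 1 / (2 * Real.sinh (β * ((m : ℝ) + 1) / 2) ^ 2)

/-- `L` is a continuous branch of `log θ`, as a function of `(r, β)`, on the open set `D` of pairs
with `β > 0`. In particular `θ` has no zero on `D`. -/
def IsLogThetaBranch (D : Set (ℂ × ℝ)) (L : ℂ × ℝ → ℂ) : Prop :=
  IsOpen D ∧ (∀ p ∈ D, 0 < p.2) ∧ ContinuousOn L D ∧
    ∀ p ∈ D, Complex.exp (L p) = theta p.2 p.1

/-- The power `θ(r)^s := exp(s log θ(r))` formed with the branch `L` of `log θ`. -/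
def thetaPow (L : ℂ × ℝ → ℂ) (s : ℂ) (β : ℝ) (r : ℂ) : ℂ :=
  Complex.exp (s * L (r, β))

/-- The (complex) second partial derivative `∂²f/∂x_j²` at `x`. -/
def partial2 {n : ℕ} (f : (Fin n → ℂ) → ℂ) (j : Fin n) (x : Fin n → ℂ) : ℂ :=
  iteratedDeriv 2 (fun t : ℂ => f (Function.update x j t)) (x j)

/-- The differential operator `H_{N,Ñ}(x, x̃)` with coupling parameter `lam`, applied to `f` and
evaluated at `(x, x̃)`. -/
def H (lam : ℂ) (β : ℝ) (N N' : ℕ) (f : (Fin N → ℂ) → (Fin N' → ℂ) → ℂ)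
    (x : Fin N → ℂ) (x' : Fin N' → ℂ) : ℂ :=
  -(∑ j : Fin N, partial2 (fun z => f z x') j x)
  + (∑ j : Fin N, ∑ k ∈ Finset.Ioi j, 2 * lam * (lam - 1) * V β (x j - x k)) * f x x'
  + lam * (∑ J : Fin N', partial2 (fun z => f x z) J x')
  + (∑ J : Fin N', ∑ K ∈ Finset.Ioi J, 2 * (lam - 1) / lam * V β (x' J - x' K)) * f x x'
  + (∑ j : Fin N, ∑ K : Fin N', 2 * (1 - lam) * V β (x j - x' K)) * f x x'

/-- The function `Ψ₀^{N,Ñ}(x, x̃)`. -/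
def Psi0 (L : ℂ × ℝ → ℂ) (lam : ℂ) (β : ℝ) {N N' : ℕ}
    (x : Fin N → ℂ) (x' : Fin N' → ℂ) : ℂ :=
  ((∏ j : Fin N, ∏ k ∈ Finset.Ioi j, thetaPow L lam β (x j - x k)) *
    (∏ J : Fin N', ∏ K ∈ Finset.Ioi J, thetaPow L (1 / lam) β (x' J - x' K))) /
  (∏ j : Fin N, ∏ J : Fin N', theta β (x j - x' J))

/-- The function `F_{N,Ñ,M,M̃}(x, x̃, y, ỹ)`. -/
def F (L : ℂ × ℝ → ℂ) (lam : ℂ) (β : ℝ) {N N' M M' : ℕ}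
    (x : Fin N → ℂ) (x' : Fin N' → ℂ) (y : Fin M → ℂ) (y' : Fin M' → ℂ) : ℂ :=
  Psi0 L lam β x x' * Psi0 L lam β y y' *
  (((∏ j : Fin N, ∏ K : Fin M', theta β (x j - y' K)) *
      (∏ J : Fin N', ∏ k : Fin M, theta β (x' J - y k))) /
    ((∏ j : Fin N, ∏ k : Fin M, thetaPow L lam β (x j - y k)) *
      (∏ J : Fin N', ∏ K : Fin M', thetaPow L (1 / lam) β (x' J - y' K))))

/-- `c · F · exp(iv[|x| - |y| - (|x̃| - |ỹ|)/λ])`, with `|x| = ∑ x_j` etc. -/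
def boostedF (L : ℂ × ℝ → ℂ) (lam c : ℂ) (v : ℝ) (β : ℝ) {N N' M M' : ℕ}
    (x : Fin N → ℂ) (x' : Fin N' → ℂ) (y : Fin M → ℂ) (y' : Fin M' → ℂ) : ℂ :=
  c * F L lam β x x' y y' *
    Complex.exp (Complex.I * (v : ℂ) *
      ((∑ j, x j) - (∑ k, y k) - ((∑ J, x' J) - (∑ K, y' K)) / lam))

/-- The constant `C_{N,M,Ñ,M̃}`; the numbers of variables are cast to `ℂ` before use. -/
def C (lam : ℂ) (β : ℝ) (N M N' M' : ℂ) : ℂ :=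
  ((N * (N - 1) - M * (M - 1)) * lam ^ 2 - (N + M) * (N' - M') * lam
      + (N - M) * (N' + M') - (N' * (N' - 1) - M' * (M' - 1)) / lam) * (c0 β : ℂ)
  + ((N - M) * ((N - M) ^ 2 - N - M) * lam ^ 2
      - (3 * (N - M) ^ 2 - N - M) * (N' - M') * lam
      + (N - M) * (3 * (N' - M') ^ 2 - N' - M')
      - (N' - M') * ((N' - M') ^ 2 - N' - M') / lam) * (c1 : ℂ)

/-- The point `(x, x̃, y, ỹ)` at `β` lies where `H_{N,Ñ}(x, x̃)`, `H_{M,M̃}(y, ỹ)` and `F` are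
defined: the arguments of all complex powers of `θ` lie in the domain `D` of the branch, and the
factors `θ(x_j - x̃_K)` and `θ(y_j - ỹ_K)` in the denominators do not vanish. The factors
`θ(x_j - ỹ_K)` and `θ(x̃_J - y_k)` of the numerator may vanish. -/
def Admissible (D : Set (ℂ × ℝ)) (β : ℝ) {N N' M M' : ℕ}
    (x : Fin N → ℂ) (x' : Fin N' → ℂ) (y : Fin M → ℂ) (y' : Fin M' → ℂ) : Prop :=
  (∀ j k, j < k → (x j - x k, β) ∈ D) ∧
  (∀ J K, J < K → (x' J - x' K, β) ∈ D) ∧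
  (∀ j k, j < k → (y j - y k, β) ∈ D) ∧
  (∀ J K, J < K → (y' J - y' K, β) ∈ D) ∧
  (∀ j k, (x j - y k, β) ∈ D) ∧
  (∀ J K, (x' J - y' K, β) ∈ D) ∧
  (∀ j K, theta β (x j - x' K) ≠ 0) ∧
  (∀ j K, theta β (y j - y' K) ≠ 0)

end EllipticCS

end

noncomputable section

namespace EllipticCS

open Filter Topology Complex

/-! All variables form one configuration `X` of particles carrying charges `m`, equal to `1`,
`-1/λ`, `-1`, `1/λ` for the species `x`, `x̃`, `y`, `ỹ`. Then `G` is a constant times the product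
over unordered pairs of `θ(X_J - X_K)^(λ m_J m_K)`, times `exp(w ∑ m_J X_J)` with `w = iv`. The
differential operator becomes `-∑ m_J⁻¹ ∂_J²`, plus the pair potentials `λ(m_J + m_K)(λ m_J m_K - 1)
V`, plus `2λ(∑ m_J) ∂_β`. For these charges every coupling between `(x, x̃)` and `(y, ỹ)` vanishes,
which is why the operator splits as a difference of two Hamiltonians.

Put `φ = θ'/θ`, so `φ' = -V`. Squaring the logarithmic derivative `λ m_J ∑ m_K φ(X_J - X_K) + w m_J`
gives three-body terms. The addition theorem `phi_add_add_sq` turns their cyclic sums into two-body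
terms and constants. Part of these cancels against the potentials; what is left is the total charge
times a sum of `V - φ²`, and the heat equation `two_mul_dlogTheta` identifies it with the
`β`-derivative. The cross terms with `w` vanish because `φ` is odd. This bookkeeping is
`source_identity_algebra`.

Both identities for `φ` come from Liouville's theorem (`eq_of_doubly_periodic`): the quasi-period
defects cancel, the singularities are removable, and the constant is read off at the origin. The
inputs are Lambert series for `V`, `φ` and `∂_β log θ`.

Factors such as `θ(x_j - ỹ_K)` may vanish at the given point, where the logarithmic computation
breaks down. There `sourceExpr_eq_zero` extends the identity by continuity from nearby points
without collisions. -/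

/-! ### Lambert series -/

/-- The set of `x` such that no `u ^ (m + 1) * x` equals `1`. -/
def lambertDomain (u : ℂ) : Set ℂ := {x | ∀ m : ℕ, u ^ (m + 1) * x ≠ 1}

theorem eventually_pow_mul_le {u : ℂ} (hu : ‖u‖ < 1) (B : ℝ) :
    ∀ᶠ m : ℕ in atTop, ‖u‖ ^ (m + 1) * B < 1 / 2 := by
  have h : Tendsto (fun m : ℕ => ‖u‖ ^ (m + 1) * B) atTop (𝓝 (0 * B)) :=
    ((tendsto_add_atTop_iff_nat 1).2
      (tendsto_pow_atTop_nhds_zero_of_lt_one (norm_nonneg u) hu)).mul_const B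
  rw [zero_mul] at h
  exact h.eventually_lt_const (by norm_num)

/-- On a bounded neighbourhood all but finitely many `u ^ (m + 1) * y` have norm below `1/2`, so
only finitely many open conditions are active. -/
theorem isOpen_lambertDomain {u : ℂ} (hu : ‖u‖ < 1) : IsOpen (lambertDomain u) := by
  rw [isOpen_iff_mem_nhds]
  intro x hx
  obtain ⟨n, hn⟩ := eventually_atTop.1 (eventually_pow_mul_le hu (‖x‖ + 1))
  have h1 : ∀ᶠ y in 𝓝 x, ∀ m ∈ Finset.range n, u ^ (m + 1) * y ≠ 1 := by
    rw [Filter.eventually_all_finset]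
    intro m _
    have : ContinuousAt (fun y : ℂ => u ^ (m + 1) * y) x := by fun_prop
    exact this.eventually_ne (hx m)
  have h2 : ∀ᶠ y in 𝓝 x, ‖y‖ < ‖x‖ + 1 :=
    continuousAt_id.norm.eventually_lt_const (by simp)
  filter_upwards [h1, h2] with y hy1 hy2 m
  rcases lt_or_ge m n with hm | hm
  · exact hy1 m (Finset.mem_range.2 hm)
  · intro h
    have h3 := hn m hm
    have h4 : ‖u‖ ^ (m + 1) * ‖y‖ = 1 := by
      rw [← norm_pow, ← norm_mul, h, norm_one]
    have h5 : ‖u‖ ^ (m + 1) * ‖y‖ ≤ ‖u‖ ^ (m + 1) * (‖x‖ + 1) := by gcongr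
    linarith

section LambertSeries

variable {u : ℂ} {c : ℕ → ℂ} {f : ℂ → ℂ} {C : ℝ}

/-- On a compact set all but finitely many arguments `u ^ (m + 1) * x` lie in the disc of radius
`1/2`, where `f t = O(t)`, and the Weierstrass test applies to that tail. The series used below are
the cases `f t = t / (1 - t)` and `f t = t / (1 - t) ^ 2`, with weights `1` or `m + 1`. -/
theorem lambert_tendstoLocallyUniformlyOn (hu : ‖u‖ < 1)
    (hc : Summable fun m => ‖c m‖ * ‖u‖ ^ (m + 1))
    (hC : 0 ≤ C) (hfC : ∀ t, ‖t‖ ≤ 1 / 2 → ‖f t‖ ≤ C * ‖t‖) :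
    TendstoLocallyUniformlyOn
      (fun (s : Finset ℕ) x => ∑ m ∈ s, c m * f (u ^ (m + 1) * x))
      (fun x => ∑' m, c m * f (u ^ (m + 1) * x)) atTop (lambertDomain u) := by
  rw [tendstoLocallyUniformlyOn_iff_forall_isCompact (isOpen_lambertDomain hu)]
  intro K _ hK
  obtain ⟨B, hB⟩ := hK.isBounded.exists_norm_le
  have hs : Summable fun m => (‖c m‖ * ‖u‖ ^ (m + 1)) * (C * B) := hc.mul_right _
  refine tendstoUniformlyOn_tsum_of_cofinite_eventually hs ?_
  rw [Nat.cofinite_eq_atTop]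
  filter_upwards [eventually_pow_mul_le hu B] with m hm x hx
  have h1 : ‖u ^ (m + 1) * x‖ ≤ ‖u‖ ^ (m + 1) * B := by
    rw [norm_mul, norm_pow]
    gcongr
    exact hB x hx
  calc ‖c m * f (u ^ (m + 1) * x)‖ = ‖c m‖ * ‖f (u ^ (m + 1) * x)‖ := norm_mul _ _
    _ ≤ ‖c m‖ * (C * (‖u‖ ^ (m + 1) * B)) := by
        gcongr
        exact (hfC _ (h1.trans hm.le)).trans (by gcongr)
    _ = _ := by ring

theorem lambert_summable (hu : ‖u‖ < 1)
    (hc : Summable fun m => ‖c m‖ * ‖u‖ ^ (m + 1))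
    (hfC : ∀ t, ‖t‖ ≤ 1 / 2 → ‖f t‖ ≤ C * ‖t‖) (x : ℂ) :
    Summable fun m => c m * f (u ^ (m + 1) * x) := by
  refine Summable.of_norm_bounded_eventually_nat (g := fun m => (‖c m‖ * ‖u‖ ^ (m + 1)) * (C * ‖x‖))
    (hc.mul_right _) ?_
  filter_upwards [eventually_pow_mul_le hu ‖x‖] with m hm
  have h1 : ‖u ^ (m + 1) * x‖ = ‖u‖ ^ (m + 1) * ‖x‖ := by
    rw [norm_mul, norm_pow]
  calc ‖c m * f (u ^ (m + 1) * x)‖ = ‖c m‖ * ‖f (u ^ (m + 1) * x)‖ := norm_mul _ _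
    _ ≤ ‖c m‖ * (C * (‖u‖ ^ (m + 1) * ‖x‖)) := by
        gcongr
        rw [← h1]
        exact hfC _ (h1 ▸ hm.le)
    _ = _ := by ring

theorem lambert_differentiableOn_partial (hf : ∀ t, t ≠ 1 → DifferentiableAt ℂ f t)
    (s : Finset ℕ) :
    DifferentiableOn ℂ (fun x => ∑ m ∈ s, c m * f (u ^ (m + 1) * x)) (lambertDomain u) := by
  refine DifferentiableOn.fun_sum fun m _ x hx => DifferentiableAt.differentiableWithinAt ?_
  have h1 : DifferentiableAt ℂ (fun y : ℂ => u ^ (m + 1) * y) x := by fun_prop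
  exact ((hf _ (hx m)).comp x h1).const_mul _

theorem lambert_differentiableAt (hu : ‖u‖ < 1)
    (hc : Summable fun m => ‖c m‖ * ‖u‖ ^ (m + 1))
    (hC : 0 ≤ C) (hfC : ∀ t, ‖t‖ ≤ 1 / 2 → ‖f t‖ ≤ C * ‖t‖)
    (hf : ∀ t, t ≠ 1 → DifferentiableAt ℂ f t) {x : ℂ} (hx : x ∈ lambertDomain u) :
    DifferentiableAt ℂ (fun x => ∑' m, c m * f (u ^ (m + 1) * x)) x :=
  ((lambert_tendstoLocallyUniformlyOn hu hc hC hfC).differentiableOn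
    (Eventually.of_forall (lambert_differentiableOn_partial hf))
    (isOpen_lambertDomain hu)).differentiableAt ((isOpen_lambertDomain hu).mem_nhds hx)

theorem lambert_hasSum_deriv (hu : ‖u‖ < 1)
    (hc : Summable fun m => ‖c m‖ * ‖u‖ ^ (m + 1))
    (hC : 0 ≤ C) (hfC : ∀ t, ‖t‖ ≤ 1 / 2 → ‖f t‖ ≤ C * ‖t‖)
    (hf : ∀ t, t ≠ 1 → DifferentiableAt ℂ f t) {x : ℂ} (hx : x ∈ lambertDomain u) :
    HasSum (fun m => c m * (deriv f (u ^ (m + 1) * x) * u ^ (m + 1)))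
      (deriv (fun x => ∑' m, c m * f (u ^ (m + 1) * x)) x) := by
  have h := ((lambert_tendstoLocallyUniformlyOn hu hc hC hfC).deriv
    (Eventually.of_forall (lambert_differentiableOn_partial hf))
    (isOpen_lambertDomain hu)).tendsto_at hx
  refine h.congr fun s => ?_
  have h2 : HasDerivAt (fun x => ∑ m ∈ s, c m * f (u ^ (m + 1) * x))
      (∑ m ∈ s, c m * (deriv f (u ^ (m + 1) * x) * u ^ (m + 1))) x := by
    refine HasDerivAt.fun_sum fun m _ => ?_
    have h1 : HasDerivAt (fun y : ℂ => u ^ (m + 1) * y) (u ^ (m + 1)) x := by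
      simpa using (hasDerivAt_id x).const_mul (u ^ (m + 1))
    exact ((hf _ (hx m)).hasDerivAt.comp x h1).const_mul _
  exact h2.deriv

end LambertSeries

/-- `∑_{m ≥ 1} u^m x / (1 - u^m x)`. -/
def lambertS (u x : ℂ) : ℂ := ∑' m : ℕ, u ^ (m + 1) * x / (1 - u ^ (m + 1) * x)

/-- `∑_{m ≥ 1} m u^m x / (1 - u^m x)`. -/
def lambertR (u x : ℂ) : ℂ :=
  ∑' m : ℕ, ((m : ℂ) + 1) * (u ^ (m + 1) * x / (1 - u ^ (m + 1) * x))

/-- `∑_{m ≥ 1} u^m x / (1 - u^m x)^2`. -/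
def lambertK (u x : ℂ) : ℂ := ∑' m : ℕ, u ^ (m + 1) * x / (1 - u ^ (m + 1) * x) ^ 2

theorem half_le_norm_one_sub {t : ℂ} (ht : ‖t‖ ≤ 1 / 2) : 1 / 2 ≤ ‖1 - t‖ := by
  have := norm_sub_norm_le (1 : ℂ) t
  rw [norm_one] at this
  linarith

theorem norm_div_one_sub_le (t : ℂ) (ht : ‖t‖ ≤ 1 / 2) : ‖t / (1 - t)‖ ≤ 2 * ‖t‖ := by
  have h := half_le_norm_one_sub ht
  rw [norm_div, div_le_iff₀ (by linarith)]
  nlinarith [norm_nonneg t]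

theorem norm_div_one_sub_sq_le (t : ℂ) (ht : ‖t‖ ≤ 1 / 2) : ‖t / (1 - t) ^ 2‖ ≤ 4 * ‖t‖ := by
  have h := half_le_norm_one_sub ht
  rw [norm_div, norm_pow, div_le_iff₀ (by positivity)]
  have : 1 / 4 ≤ ‖1 - t‖ ^ 2 := by nlinarith
  nlinarith [norm_nonneg t]

theorem hasDerivAt_div_one_sub {t : ℂ} (ht : t ≠ 1) :
    HasDerivAt (fun t : ℂ => t / (1 - t)) (1 / (1 - t) ^ 2) t := by
  have h : 1 - t ≠ 0 := sub_ne_zero.2 (Ne.symm ht)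
  have h1 : HasDerivAt (fun t : ℂ => 1 - t) (-1) t := by
    simpa using (hasDerivAt_id t).const_sub 1
  convert! (hasDerivAt_id t).div h1 h using 1
  simp

theorem differentiableAt_div_one_sub_sq {t : ℂ} (ht : t ≠ 1) :
    DifferentiableAt ℂ (fun t : ℂ => t / (1 - t) ^ 2) t := by
  have h : (1 - t) ^ 2 ≠ 0 := pow_ne_zero 2 (sub_ne_zero.2 (Ne.symm ht))
  fun_prop (disch := exact h)

theorem summable_one_weight {u : ℂ} (hu : ‖u‖ < 1) :
    Summable fun m : ℕ => ‖(1 : ℂ)‖ * ‖u‖ ^ (m + 1) := by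
  simpa using (summable_nat_add_iff 1).2 (summable_geometric_of_lt_one (norm_nonneg u) hu)

theorem summable_nat_weight {u : ℂ} (hu : ‖u‖ < 1) :
    Summable fun m : ℕ => ‖(m : ℂ) + 1‖ * ‖u‖ ^ (m + 1) := by
  have h := (summable_nat_add_iff 1).2
    (summable_pow_mul_geometric_of_norm_lt_one 1 (r := ‖u‖) (by simpa using hu))
  refine h.congr fun m => ?_
  have : ‖(m : ℂ) + 1‖ = (m : ℝ) + 1 := by
    have := Complex.norm_natCast (m + 1)
    push_cast at this
    exact this
  rw [this]
  push_cast
  ring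

theorem summable_lambertS {u : ℂ} (hu : ‖u‖ < 1) (x : ℂ) :
    Summable fun m : ℕ => u ^ (m + 1) * x / (1 - u ^ (m + 1) * x) := by
  simpa using lambert_summable hu (summable_one_weight hu) norm_div_one_sub_le x

theorem summable_lambertR {u : ℂ} (hu : ‖u‖ < 1) (x : ℂ) :
    Summable fun m : ℕ => ((m : ℂ) + 1) * (u ^ (m + 1) * x / (1 - u ^ (m + 1) * x)) :=
  lambert_summable hu (summable_nat_weight hu) norm_div_one_sub_le x

theorem summable_lambertK {u : ℂ} (hu : ‖u‖ < 1) (x : ℂ) :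
    Summable fun m : ℕ => u ^ (m + 1) * x / (1 - u ^ (m + 1) * x) ^ 2 := by
  simpa using lambert_summable hu (summable_one_weight hu) norm_div_one_sub_sq_le x

theorem hasDerivAt_lambertS {u : ℂ} (hu : ‖u‖ < 1) {x : ℂ} (hx : x ∈ lambertDomain u) (hx0 : x ≠ 0) :
    HasDerivAt (lambertS u) (lambertK u x / x) x := by
  have hd := lambert_differentiableAt hu (summable_one_weight hu) zero_le_two norm_div_one_sub_le
    (fun t ht => (hasDerivAt_div_one_sub ht).differentiableAt) hx
  have hs := lambert_hasSum_deriv hu (summable_one_weight hu) zero_le_two norm_div_one_sub_le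
    (fun t ht => (hasDerivAt_div_one_sub ht).differentiableAt) hx
  simp only [one_mul] at hd hs
  have h2 := (summable_lambertK hu x).hasSum.div_const x
  have h3 : deriv (lambertS u) x = lambertK u x / x := by
    refine hs.unique ?_
    convert! h2 using 2 with m
    rw [(hasDerivAt_div_one_sub (hx m)).deriv]
    have : 1 - u ^ (m + 1) * x ≠ 0 := sub_ne_zero.2 (hx m).symm
    field_simp
  rw [← h3]
  exact hd.hasDerivAt

theorem differentiableAt_lambertR {u : ℂ} (hu : ‖u‖ < 1) {x : ℂ} (hx : x ∈ lambertDomain u) :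
    DifferentiableAt ℂ (lambertR u) x :=
  lambert_differentiableAt hu (summable_nat_weight hu) zero_le_two norm_div_one_sub_le
    (fun _ ht => (hasDerivAt_div_one_sub ht).differentiableAt) hx

theorem differentiableAt_lambertK {u : ℂ} (hu : ‖u‖ < 1) {x : ℂ} (hx : x ∈ lambertDomain u) :
    DifferentiableAt ℂ (lambertK u) x := by
  have h := lambert_differentiableAt hu (summable_one_weight hu) zero_le_four
    norm_div_one_sub_sq_le (fun _ ht => differentiableAt_div_one_sub_sq ht) hx
  simp only [one_mul] at h
  exact h

/-- Multiplying the argument by `u` shifts the index by one, so the first term drops out. These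
shifts become the period `iβ`. -/
theorem lambertS_mul {u : ℂ} (hu : ‖u‖ < 1) (x : ℂ) :
    lambertS u (u * x) = lambertS u x - u * x / (1 - u * x) := by
  have h := (summable_lambertS hu x).tsum_eq_zero_add
  rw [lambertS, lambertS, h]
  simp only [zero_add, pow_one, add_sub_cancel_left]
  refine tsum_congr fun m => ?_
  rw [show u ^ (m + 1) * (u * x) = u ^ (m + 1 + 1) * x by ring]

/-- The index shift lowers each weight by one, and the term whose weight becomes `0` is harmless. -/
theorem lambertR_mul {u : ℂ} (hu : ‖u‖ < 1) (x : ℂ) : lambertR u (u * x) = lambertR u x - lambertS u x := by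
  have h1 := (summable_lambertR hu x).sub (summable_lambertS hu x)
  have h2 := (summable_lambertR hu x).tsum_sub (summable_lambertS hu x)
  rw [lambertR, lambertR, lambertS, ← h2, h1.tsum_eq_zero_add]
  simp only [Nat.cast_zero, zero_add, one_mul, sub_self]
  refine tsum_congr fun m => ?_
  rw [show u ^ (m + 1) * (u * x) = u ^ (m + 1 + 1) * x by ring]
  push_cast
  ring

theorem norm_pow_lt_one {u : ℂ} (hu : ‖u‖ < 1) (m : ℕ) : ‖u ^ (m + 1)‖ < 1 := by
  rw [norm_pow]
  exact pow_lt_one₀ (norm_nonneg u) hu (Nat.succ_ne_zero m)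

theorem one_mem_lambertDomain {u : ℂ} (hu : ‖u‖ < 1) : (1 : ℂ) ∈ lambertDomain u := by
  intro m h
  have := norm_pow_lt_one hu m
  rw [mul_one] at h
  rw [h, norm_one] at this
  exact lt_irrefl _ this

/-- Both sides are the double series `∑ m u^(m k)` over `m, k ≥ 1`. -/
theorem lambertR_one {u : ℂ} (hu : ‖u‖ < 1) : lambertR u 1 = lambertK u 1 := by
  have hgeo : ∀ m : ℕ, HasSum (fun k : ℕ => ((m : ℂ) + 1) * u ^ ((m + 1) * (k + 1)))
      (((m : ℂ) + 1) * (u ^ (m + 1) / (1 - u ^ (m + 1)))) := by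
    intro m
    have := ((hasSum_geometric_of_norm_lt_one (norm_pow_lt_one hu m)).mul_left
      (u ^ (m + 1))).mul_left ((m : ℂ) + 1)
    convert! this using 2 with k
    · rw [← pow_mul]; ring
  have hder : ∀ k : ℕ, HasSum (fun m : ℕ => ((m : ℂ) + 1) * u ^ ((m + 1) * (k + 1)))
      (u ^ (k + 1) / (1 - u ^ (k + 1)) ^ 2) := by
    intro k
    have h := hasSum_coe_mul_geometric_of_norm_lt_one (norm_pow_lt_one hu k)
    rw [← hasSum_nat_add_iff' 1] at h
    simp only [Finset.sum_range_one, Nat.cast_zero, zero_mul, sub_zero] at h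
    convert! h using 2 with m
    rw [← pow_mul]
    push_cast
    ring
  -- Since `(m+1)(k+1) ≥ (m+1) + k`, the double series is dominated by a product of two convergent
  -- single series.
  have hsum : Summable fun p : ℕ × ℕ => ((p.1 : ℂ) + 1) * u ^ ((p.1 + 1) * (p.2 + 1)) := by
    have hn : ∀ m : ℕ, ‖(m : ℂ) + 1‖ = (m : ℝ) + 1 := by
      intro m
      have := Complex.norm_natCast (m + 1)
      push_cast at this
      exact this
    have hA := summable_nat_weight hu
    have hB := (summable_geometric_of_lt_one (norm_nonneg u) hu)
    have hAB := hA.mul_of_nonneg hB (fun m => by positivity) (fun m => by positivity)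
    refine Summable.of_norm_bounded hAB fun p => ?_
    rw [norm_mul, norm_pow, mul_assoc, ← pow_add]
    refine mul_le_mul_of_nonneg_left (pow_le_pow_of_le_one (norm_nonneg u) hu.le ?_)
      (norm_nonneg _)
    have h3 : (p.1 + 1) * (p.2 + 1) = p.1 + 1 + p.2 + p.1 * p.2 := by ring
    rw [h3]
    exact Nat.le_add_right _ _
  have h1 : lambertR u 1 = ∑' m : ℕ, ∑' k : ℕ, ((m : ℂ) + 1) * u ^ ((m + 1) * (k + 1)) := by
    simp only [lambertR, mul_one]
    exact tsum_congr fun m => (hgeo m).tsum_eq.symm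
  have h2 : lambertK u 1 = ∑' k : ℕ, ∑' m : ℕ, ((m : ℂ) + 1) * u ^ ((m + 1) * (k + 1)) := by
    simp only [lambertK, mul_one]
    exact tsum_congr fun m => (hder m).tsum_eq.symm
  rw [h1, h2]
  exact (Summable.tsum_comm (f := fun m k : ℕ => ((m : ℂ) + 1) * u ^ ((m + 1) * (k + 1))) hsum).symm

/-! ### The infinite product for θ, with complex `β` -/

/-- The deviation from `1` of the `m`-th factor of `θ`, for complex `b` in the place of `β`. -/
def factorSubOne (m : ℕ) (r b : ℂ) : ℂ :=
  exp (-b * (m + 1)) * (exp (-b * (m + 1)) - 2 * cos r)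

/-- The infinite product in `θ`, for complex `b` in the place of `β`. -/
def thetaProd (r b : ℂ) : ℂ := ∏' m : ℕ, (1 + factorSubOne m r b)

/-- `e^{-β}`, as a complex number. -/
def nomeSq (β : ℝ) : ℂ := exp (-(β : ℂ))

theorem nomeSq_ne_zero (β : ℝ) : nomeSq β ≠ 0 := exp_ne_zero _

theorem norm_nomeSq_lt_one {β : ℝ} (hβ : 0 < β) : ‖nomeSq β‖ < 1 := by
  rw [nomeSq, norm_exp]
  simpa using hβ

theorem exp_neg_mul_succ (β : ℝ) (m : ℕ) : exp (-(β : ℂ) * (m + 1)) = nomeSq β ^ (m + 1) := by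
  rw [nomeSq, ← exp_nat_mul]
  push_cast
  ring_nf

theorem nome_pow (β : ℝ) (m : ℕ) : (nome β : ℂ) ^ (2 * m) = nomeSq β ^ m := by
  rw [pow_mul, nomeSq, nome, ofReal_exp, ← exp_nat_mul]
  push_cast
  ring_nf

theorem theta_eq (β : ℝ) (r : ℂ) : theta β r = sin (r / 2) * thetaProd r β := by
  rw [theta, thetaProd]
  congr 1
  refine tprod_congr fun m => ?_
  rw [factorSubOne, exp_neg_mul_succ, nome_pow, show 4 * (m + 1) = 2 * (2 * (m + 1)) by ring,
    nome_pow]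
  ring

theorem norm_cos_le (r : ℂ) : ‖cos r‖ ≤ Real.exp ‖r‖ := by
  have h1 : ‖exp (r * I)‖ ≤ Real.exp ‖r‖ := by
    simpa using norm_exp_le_exp_norm (r * I)
  have h2 : ‖exp (-r * I)‖ ≤ Real.exp ‖r‖ := by
    simpa using norm_exp_le_exp_norm (-r * I)
  rw [cos, norm_div, norm_ofNat, div_le_iff₀ two_pos]
  exact (norm_add_le _ _).trans (by linarith)

/-- The set on which the factors of `θ` are uniformly bounded. -/
def boundedRegion (R ρ : ℝ) : Set (ℂ × ℂ) := Metric.ball 0 R ×ˢ {b | ρ < b.re}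

theorem isOpen_boundedRegion (R ρ : ℝ) : IsOpen (boundedRegion R ρ) :=
  Metric.isOpen_ball.prod (isOpen_lt continuous_const continuous_re)

theorem norm_factorSubOne_le {R ρ : ℝ} (hρ : 0 < ρ) (m : ℕ) {p : ℂ × ℂ}
    (hp : p ∈ boundedRegion R ρ) :
    ‖factorSubOne m p.1 p.2‖ ≤ Real.exp (-ρ) ^ (m + 1) * (1 + 2 * Real.exp R) := by
  have hb : ρ < p.2.re := hp.2
  have hr : ‖p.1‖ < R := by simpa using hp.1
  have hm : (0 : ℝ) < (m : ℝ) + 1 := by positivity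
  have hre : (-p.2 * ((m : ℂ) + 1)).re = -(p.2.re * ((m : ℝ) + 1)) := by
    simp
  have h1 : ‖exp (-p.2 * (m + 1))‖ ≤ Real.exp (-ρ) ^ (m + 1) := by
    rw [norm_exp, ← Real.exp_nat_mul, Real.exp_le_exp, hre]
    push_cast
    nlinarith
  have h2 : Real.exp (-ρ) ^ (m + 1) ≤ 1 :=
    pow_le_one₀ (Real.exp_pos _).le (Real.exp_le_one_iff.2 (by linarith))
  have h3 : ‖cos p.1‖ ≤ Real.exp R := (norm_cos_le _).trans (Real.exp_le_exp.2 hr.le)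
  rw [factorSubOne, norm_mul]
  gcongr
  refine (norm_sub_le _ _).trans ?_
  rw [norm_mul, norm_ofNat]
  gcongr
  exact h1.trans h2

theorem summable_bound {ρ : ℝ} (hρ : 0 < ρ) (K : ℝ) :
    Summable fun m : ℕ => Real.exp (-ρ) ^ (m + 1) * K :=
  ((summable_nat_add_iff 1).2 (summable_geometric_of_lt_one (Real.exp_pos _).le
    (by simpa using hρ))).mul_right _

theorem continuous_factorSubOne (m : ℕ) :
    Continuous fun p : ℂ × ℂ => factorSubOne m p.1 p.2 := by
  unfold factorSubOne
  fun_prop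

/-- Convergence is uniform jointly in `(r, b)`, so the slices in either variable and the joint
continuity all come from this one statement. Complex `b` makes Weierstrass' theorem available in the
parameter too. -/
theorem hasProdLocallyUniformlyOn_theta (R : ℝ) {ρ : ℝ} (hρ : 0 < ρ) :
    HasProdLocallyUniformlyOn (fun m (p : ℂ × ℂ) => 1 + factorSubOne m p.1 p.2)
      (fun p => thetaProd p.1 p.2) (boundedRegion R ρ) :=
  Summable.hasProdLocallyUniformlyOn_nat_one_add (isOpen_boundedRegion R ρ)
    (summable_bound hρ _) (Eventually.of_forall fun m _ hp => norm_factorSubOne_le hρ m hp)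
    fun m => (continuous_factorSubOne m).continuousOn

theorem mem_boundedRegion {r b : ℂ} (hb : 0 < b.re) :
    (r, b) ∈ boundedRegion (‖r‖ + 1) (b.re / 2) :=
  ⟨by simp, half_lt_self hb⟩

theorem continuousAt_thetaProd {r b : ℂ} (hb : 0 < b.re) :
    ContinuousAt (fun p : ℂ × ℂ => thetaProd p.1 p.2) (r, b) := by
  have h := hasProdLocallyUniformlyOn_theta (‖r‖ + 1) (half_pos hb)
  rw [hasProdLocallyUniformlyOn_iff_tendstoLocallyUniformlyOn] at h
  refine (h.continuousOn (Frequently.of_forall fun s => ?_)).continuousAt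
    ((isOpen_boundedRegion _ _).mem_nhds (mem_boundedRegion hb))
  exact (continuous_finsetProd _ fun m _ =>
    continuous_const.add (continuous_factorSubOne m)).continuousOn

theorem summable_factorSubOne (r : ℂ) {b : ℂ} (hb : 0 < b.re) :
    Summable fun m => ‖factorSubOne m r b‖ :=
  Summable.of_nonneg_of_le (fun _ => norm_nonneg _)
    (fun m => norm_factorSubOne_le (half_pos hb) m (mem_boundedRegion hb))
    (summable_bound (half_pos hb) _)

theorem thetaProd_ne_zero_iff {r b : ℂ} (hb : 0 < b.re) :
    thetaProd r b ≠ 0 ↔ ∀ m, 1 + factorSubOne m r b ≠ 0 := by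
  refine ⟨fun h m hm => h ?_, fun h => ?_⟩
  · exact tprod_of_exists_eq_zero ⟨m, hm⟩
  · exact tprod_one_add_ne_zero_of_summable h (summable_factorSubOne r hb)

theorem multipliable_left (R : ℝ) {b : ℂ} (hb : 0 < b.re) :
    MultipliableLocallyUniformlyOn (fun m r => 1 + factorSubOne m r b) (Metric.ball 0 R) :=
  (hasProdLocallyUniformlyOn_theta R (half_pos hb)).multipliableLocallyUniformlyOn.comp
    (fun r => (r, b)) (fun _ hr => ⟨hr, half_lt_self hb⟩) (by fun_prop)

theorem multipliable_right (r : ℂ) {ρ : ℝ} (hρ : 0 < ρ) :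
    MultipliableLocallyUniformlyOn (fun m b => 1 + factorSubOne m r b) {b | ρ < b.re} :=
  (hasProdLocallyUniformlyOn_theta (‖r‖ + 1) hρ).multipliableLocallyUniformlyOn.comp
    (fun b => (r, b)) (fun _ hb => ⟨by simp, hb⟩) (by fun_prop)

theorem differentiable_factor_left (m : ℕ) (b : ℂ) :
    Differentiable ℂ fun r => 1 + factorSubOne m r b := by
  unfold factorSubOne
  fun_prop

theorem differentiable_factor_right (m : ℕ) (r : ℂ) :
    Differentiable ℂ fun b => 1 + factorSubOne m r b := by
  unfold factorSubOne
  fun_prop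

theorem differentiable_thetaProd_left {b : ℂ} (hb : 0 < b.re) :
    Differentiable ℂ fun r => thetaProd r b := by
  intro r
  have h := (multipliable_left (‖r‖ + 1) hb).hasProdLocallyUniformlyOn
  rw [hasProdLocallyUniformlyOn_iff_tendstoLocallyUniformlyOn] at h
  refine (h.differentiableOn (Eventually.of_forall fun s => ?_)
    Metric.isOpen_ball).differentiableAt (Metric.isOpen_ball.mem_nhds (by simp))
  exact (Differentiable.fun_finsetProd fun m _ => differentiable_factor_left m b).differentiableOn

theorem differentiableOn_thetaProd_right (r : ℂ) {ρ : ℝ} (hρ : 0 < ρ) :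
    DifferentiableOn ℂ (fun b => thetaProd r b) {b | ρ < b.re} := by
  have h := (multipliable_right r hρ).hasProdLocallyUniformlyOn
  rw [hasProdLocallyUniformlyOn_iff_tendstoLocallyUniformlyOn] at h
  refine h.differentiableOn (Eventually.of_forall fun s => ?_)
    (isOpen_lt continuous_const continuous_re)
  exact (Differentiable.fun_finsetProd fun m _ => differentiable_factor_right m r).differentiableOn

theorem differentiableAt_thetaProd_right (r : ℂ) {b : ℂ} (hb : 0 < b.re) :
    DifferentiableAt ℂ (fun b => thetaProd r b) b :=
  (differentiableOn_thetaProd_right r (half_pos hb)).differentiableAt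
    ((isOpen_lt continuous_const continuous_re).mem_nhds (half_lt_self hb))

/-- The `b`-derivative of the product is continuous in `r`. -/
theorem continuous_deriv_thetaProd_right {b : ℂ} (hb : 0 < b.re) :
    Continuous fun r => deriv (fun b => thetaProd r b) b := by
  rw [continuous_iff_continuousAt]
  intro r
  set U : Set ℂ := {z | b.re / 2 < z.re} with hU
  have hUo : IsOpen U := isOpen_lt continuous_const continuous_re
  have hbU : b ∈ U := half_lt_self hb
  -- Joint continuity, hence uniform continuity on a closed ball times a compact set, makes
  -- `thetaProd s` tend to `thetaProd r` locally uniformly in `b` as `s → r`. By Weierstrass the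
  -- `b`-derivatives then converge as well.
  have h : TendstoLocallyUniformlyOn (fun r b => thetaProd r b) (fun b => thetaProd r b)
      (𝓝 r) U := by
    rw [tendstoLocallyUniformlyOn_iff_forall_isCompact hUo]
    intro K hKU hK
    have hc : ContinuousOn (fun p : ℂ × ℂ => thetaProd p.1 p.2) (Metric.closedBall r 1 ×ˢ K) := by
      rintro ⟨s, z⟩ ⟨_, hz⟩
      have hz' : b.re / 2 < z.re := hKU hz
      exact (continuousAt_thetaProd (by linarith)).continuousWithinAt
    have huc := ((isCompact_closedBall r 1).prod hK).uniformContinuousOn_of_continuous hc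
    have ht := UniformContinuousOn.tendstoUniformlyOn (F := fun r b => thetaProd r b) huc
      (Metric.mem_closedBall_self zero_le_one)
    rwa [nhdsWithin_eq_nhds.2 (Metric.closedBall_mem_nhds r one_pos)] at ht
  have h2 := h.deriv (Eventually.of_forall fun s =>
    differentiableOn_thetaProd_right s (half_pos hb)) hUo
  exact h2.tendsto_at hbU

/-! ### Logarithmic derivatives of the product -/

theorem factor_eq (β : ℝ) (m : ℕ) (r : ℂ) :
    1 + factorSubOne m r β
      = (1 - nomeSq β ^ (m + 1) * exp (I * r)) * (1 - nomeSq β ^ (m + 1) * exp (-(I * r))) := by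
  rw [factorSubOne, exp_neg_mul_succ]
  have h1 : exp (I * r) * exp (-(I * r)) = 1 := by rw [← exp_add]; simp
  have h2 : 2 * cos r = exp (I * r) + exp (-(I * r)) := by
    rw [two_cos, mul_comm r I, neg_mul, mul_comm r I]
  rw [h2]
  linear_combination (- (nomeSq β ^ (m + 1)) ^ 2) * h1

theorem thetaProd_ne_zero_iff_mem {β : ℝ} (hβ : 0 < β) (r : ℂ) :
    thetaProd r β ≠ 0 ↔
      exp (I * r) ∈ lambertDomain (nomeSq β) ∧ exp (-(I * r)) ∈ lambertDomain (nomeSq β) := by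
  rw [thetaProd_ne_zero_iff (by simpa using hβ)]
  simp only [factor_eq, mul_ne_zero_iff, forall_and, lambertDomain, Set.mem_ofPred_eq, sub_ne_zero,
    ne_comm (a := (1 : ℂ))]

theorem logDeriv_thetaProd_left {β : ℝ} (hβ : 0 < β) {r : ℂ} (hr : thetaProd r β ≠ 0) :
    logDeriv (fun r => thetaProd r β) r
      = -I * lambertS (nomeSq β) (exp (I * r)) + I * lambertS (nomeSq β) (exp (-(I * r))) := by
  have hb : 0 < (β : ℂ).re := by simpa using hβ
  have hu := norm_nomeSq_lt_one hβ
  obtain ⟨h1, h2⟩ := (thetaProd_ne_zero_iff_mem hβ r).1 hr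
  have hsum := ((summable_lambertS hu (exp (I * r))).hasSum.mul_left (-I)).add
    ((summable_lambertS hu (exp (-(I * r)))).hasSum.mul_left I)
  have hterm : ∀ m, logDeriv (fun r => 1 + factorSubOne m r β) r
      = -I * (nomeSq β ^ (m + 1) * exp (I * r) / (1 - nomeSq β ^ (m + 1) * exp (I * r)))
        + I * (nomeSq β ^ (m + 1) * exp (-(I * r))
          / (1 - nomeSq β ^ (m + 1) * exp (-(I * r)))) := by
    intro m
    have e1 : 1 - nomeSq β ^ (m + 1) * exp (I * r) ≠ 0 := sub_ne_zero.2 (h1 m).symm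
    have e2 : 1 - nomeSq β ^ (m + 1) * exp (-(I * r)) ≠ 0 := sub_ne_zero.2 (h2 m).symm
    have d1 : HasDerivAt (fun r => exp (I * r)) (exp (I * r) * I) r := by
      simpa using ((hasDerivAt_id r).const_mul I).cexp
    have d2 : HasDerivAt (fun r => exp (-(I * r))) (exp (-(I * r)) * (-I)) r := by
      simpa using ((hasDerivAt_id r).const_mul I).neg.cexp
    have d3 := ((d1.const_mul (nomeSq β ^ (m + 1))).const_sub 1).mul
      ((d2.const_mul (nomeSq β ^ (m + 1))).const_sub 1)
    have d4 := d3.congr_of_eventuallyEq (f₁ := fun r => 1 + factorSubOne m r β)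
      (Eventually.of_forall fun r => factor_eq β m r)
    rw [logDeriv_apply, d4.deriv, factor_eq]
    field_simp
  have hs : HasSum (fun m => logDeriv (fun r => 1 + factorSubOne m r β) r) _ :=
    hsum.congr_fun hterm
  have := logDeriv_tprod_eq_tsum (Metric.isOpen_ball (x := (0 : ℂ)) (ε := ‖r‖ + 1))
    (x := r) (by simp) (f := fun m r => 1 + factorSubOne m r β)
    ((thetaProd_ne_zero_iff hb).1 hr)
    (fun m => (differentiable_factor_left m β).differentiableOn) hs.summable
    (multipliable_left _ hb) hr
  exact this.trans hs.tsum_eq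

theorem logDeriv_thetaProd_right {β : ℝ} (hβ : 0 < β) {r : ℂ} (hr : thetaProd r β ≠ 0) :
    logDeriv (fun b => thetaProd r b) β
      = lambertR (nomeSq β) (exp (I * r)) + lambertR (nomeSq β) (exp (-(I * r))) := by
  have hb : 0 < (β : ℂ).re := by simpa using hβ
  have hu := norm_nomeSq_lt_one hβ
  obtain ⟨h1, h2⟩ := (thetaProd_ne_zero_iff_mem hβ r).1 hr
  have hsum := (summable_lambertR hu (exp (I * r))).hasSum.add
    (summable_lambertR hu (exp (-(I * r)))).hasSum
  have hterm : ∀ m, logDeriv (fun b => 1 + factorSubOne m r b) β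
      = ((m : ℂ) + 1) * (nomeSq β ^ (m + 1) * exp (I * r)
          / (1 - nomeSq β ^ (m + 1) * exp (I * r)))
        + ((m : ℂ) + 1) * (nomeSq β ^ (m + 1) * exp (-(I * r))
          / (1 - nomeSq β ^ (m + 1) * exp (-(I * r)))) := by
    intro m
    have e1 : 1 - nomeSq β ^ (m + 1) * exp (I * r) ≠ 0 := sub_ne_zero.2 (h1 m).symm
    have e2 : 1 - nomeSq β ^ (m + 1) * exp (-(I * r)) ≠ 0 := sub_ne_zero.2 (h2 m).symm
    have d1 : HasDerivAt (fun b : ℂ => exp (-b * (m + 1)))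
        (exp (-(β : ℂ) * (m + 1)) * (-((m : ℂ) + 1))) β := by
      simpa using ((hasDerivAt_id (β : ℂ)).neg.mul_const ((m : ℂ) + 1)).cexp
    have d3 := (d1.mul (d1.sub_const (2 * cos r))).const_add 1
    rw [logDeriv_apply, factor_eq]
    have d4 : HasDerivAt (fun b => 1 + factorSubOne m r b) _ β := d3
    rw [d4.deriv, exp_neg_mul_succ]
    have h3 : exp (I * r) * exp (-(I * r)) = 1 := by rw [← exp_add]; simp
    have h4 : 2 * cos r = exp (I * r) + exp (-(I * r)) := by
      rw [two_cos, mul_comm r I, neg_mul, mul_comm r I]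
    rw [h4]
    field_simp
    linear_combination (2 * (nomeSq β ^ (m + 1)) ^ 2) * h3
  have hs : HasSum (fun m => logDeriv (fun b => 1 + factorSubOne m r b) β) _ :=
    hsum.congr_fun hterm
  have := logDeriv_tprod_eq_tsum (isOpen_lt (continuous_const (y := β / 2)) continuous_re)
    (x := (β : ℂ)) (by simpa using half_lt_self hβ) (f := fun m b => 1 + factorSubOne m r b)
    ((thetaProd_ne_zero_iff hb).1 hr)
    (fun m => (differentiable_factor_right m r).differentiableOn) hs.summable
    (multipliable_right _ (half_pos hβ)) hr
  exact this.trans hs.tsum_eq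

/-! ### Zeros and periods of θ -/

/-- The logarithmic derivative `θ'/θ`, as a series. -/
def phi (β : ℝ) (r : ℂ) : ℂ :=
  cos (r / 2) / (2 * sin (r / 2)) - I * lambertS (nomeSq β) (exp (I * r))
    + I * lambertS (nomeSq β) (exp (-(I * r)))

/-- The logarithmic derivative of `θ` with respect to `β`, as a series. -/
def dlogTheta (β : ℝ) (r : ℂ) : ℂ :=
  lambertR (nomeSq β) (exp (I * r)) + lambertR (nomeSq β) (exp (-(I * r)))

/-- The derivative of `θ` with respect to `β`. -/
def thetaDot (β : ℝ) (r : ℂ) : ℂ := sin (r / 2) * deriv (fun b => thetaProd r b) β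

theorem sin_half_ne_zero_iff (r : ℂ) : sin (r / 2) ≠ 0 ↔ exp (I * r) ≠ 1 := by
  rw [not_iff_not, sin_eq_zero_iff, exp_eq_one_iff]
  refine exists_congr fun n => ⟨fun h => ?_, fun h => ?_⟩
  · linear_combination 2 * I * h
  · have := mul_left_cancel₀ I_ne_zero (h.trans (by ring : (n : ℂ) * (2 * Real.pi * I) = I * (n * (2 * Real.pi))))
    linear_combination this / 2

theorem theta_ne_zero_iff {β : ℝ} (hβ : 0 < β) (r : ℂ) :
    theta β r ≠ 0 ↔ sin (r / 2) ≠ 0 ∧ exp (I * r) ∈ lambertDomain (nomeSq β) ∧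
      exp (-(I * r)) ∈ lambertDomain (nomeSq β) := by
  rw [theta_eq, mul_ne_zero_iff, thetaProd_ne_zero_iff_mem hβ]

/-- The zeros of the sine supply `n = 0` and the two families of factors supply the positive and
negative `n`. In this form translation by `iβ` is a shift of `n`. -/
theorem theta_ne_zero_iff_zpow {β : ℝ} (hβ : 0 < β) (r : ℂ) :
    theta β r ≠ 0 ↔ ∀ n : ℤ, nomeSq β ^ n * exp (I * r) ≠ 1 := by
  rw [theta_ne_zero_iff hβ, sin_half_ne_zero_iff]
  have hu := nomeSq_ne_zero β
  have hneg : ∀ m : ℕ, nomeSq β ^ (m + 1) * exp (-(I * r)) = 1 ↔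
      nomeSq β ^ (-((m : ℤ) + 1)) * exp (I * r) = 1 := by
    intro m
    have h : nomeSq β ^ (-((m : ℤ) + 1)) = (nomeSq β ^ (m + 1))⁻¹ := by
      rw [zpow_neg]; norm_cast
    have hu' := pow_ne_zero (m + 1) hu
    rw [h, exp_neg, ← div_eq_mul_inv, div_eq_one_iff_eq (exp_ne_zero _), inv_mul_eq_one₀ hu']
  constructor
  · rintro ⟨h0, h1, h2⟩ n
    obtain ⟨m, rfl | rfl⟩ := n.eq_nat_or_neg
    · rcases m with _ | m
      · simpa using h0
      · exact_mod_cast h1 m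
    · rcases m with _ | m
      · simpa using h0
      · have := h2 m
        rw [Ne, hneg] at this
        exact_mod_cast this
  · intro h
    refine ⟨by simpa using h 0, fun m => by exact_mod_cast h ((m + 1 : ℕ) : ℤ), fun m => ?_⟩
    rw [Ne, hneg]
    exact h _

theorem exp_I_mul_add_period (β : ℝ) (r : ℂ) :
    exp (I * (r + I * β)) = nomeSq β * exp (I * r) := by
  rw [nomeSq, ← exp_add]
  congr 1
  linear_combination (β : ℂ) * I_mul_I

theorem exp_neg_I_mul_add_period (β : ℝ) (r : ℂ) :
    nomeSq β * exp (-(I * (r + I * β))) = exp (-(I * r)) := by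
  rw [nomeSq, ← exp_add]
  congr 1
  linear_combination -(β : ℂ) * I_mul_I

theorem exp_I_mul_add_two_pi (r : ℂ) : exp (I * (r + 2 * Real.pi)) = exp (I * r) := by
  rw [show I * (r + 2 * Real.pi) = I * r + 2 * Real.pi * I by ring, exp_periodic]

theorem exp_neg_I_mul_add_two_pi (r : ℂ) :
    exp (-(I * (r + 2 * Real.pi))) = exp (-(I * r)) := by
  rw [exp_neg, exp_I_mul_add_two_pi, exp_neg]

theorem theta_ne_zero_add_period {β : ℝ} (hβ : 0 < β) (r : ℂ) :
    theta β (r + I * β) ≠ 0 ↔ theta β r ≠ 0 := by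
  rw [theta_ne_zero_iff_zpow hβ, theta_ne_zero_iff_zpow hβ, exp_I_mul_add_period]
  have hu := nomeSq_ne_zero β
  constructor
  · intro h n
    have := h (n - 1)
    rwa [← mul_assoc, ← zpow_add_one₀ hu, sub_add_cancel] at this
  · intro h n
    rw [← mul_assoc, ← zpow_add_one₀ hu]
    exact h _

theorem theta_neg (β : ℝ) (r : ℂ) : theta β (-r) = -theta β r := by
  rw [theta, theta, neg_div, sin_neg, cos_neg, neg_mul]

theorem theta_neg_ne_zero {β : ℝ} {r : ℂ} (h : theta β r ≠ 0) : theta β (-r) ≠ 0 := by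
  rw [theta_neg]
  exact neg_ne_zero.2 h

theorem ofReal_re_pos {β : ℝ} (hβ : 0 < β) : 0 < (β : ℂ).re := by simpa using hβ

theorem differentiable_theta {β : ℝ} (hβ : 0 < β) : Differentiable ℂ (theta β) := by
  have h : theta β = fun r => sin (r / 2) * thetaProd r β := funext (theta_eq β)
  rw [h]
  have := differentiable_thetaProd_left (ofReal_re_pos hβ)
  fun_prop

theorem hasDerivAt_half (r : ℂ) : HasDerivAt (fun r : ℂ => r / 2) (1 / 2) r :=
  (hasDerivAt_id r).div_const 2

theorem hasDerivAt_theta {β : ℝ} (hβ : 0 < β) {r : ℂ} (hr : theta β r ≠ 0) :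
    HasDerivAt (theta β) (phi β r * theta β r) r := by
  have h : theta β = fun r => sin (r / 2) * thetaProd r β := funext (theta_eq β)
  have hP : thetaProd r β ≠ 0 := by
    rw [theta_eq] at hr
    exact right_ne_zero_of_mul hr
  have hs : sin (r / 2) ≠ 0 := ((theta_ne_zero_iff hβ r).1 hr).1
  have hd := (differentiable_thetaProd_left (ofReal_re_pos hβ) r).hasDerivAt
  have hl := logDeriv_thetaProd_left hβ hP
  rw [logDeriv_apply, div_eq_iff hP] at hl
  rw [hl] at hd
  have h1 := (hasDerivAt_half r).csin.mul hd
  rw [h]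
  refine h1.congr_deriv ?_
  rw [phi]
  field_simp
  ring

theorem hasDerivAt_theta_param_dot {β : ℝ} (hβ : 0 < β) (r : ℂ) :
    HasDerivAt (fun b : ℝ => theta b r) (thetaDot β r) β := by
  have hd := (differentiableAt_thetaProd_right r (ofReal_re_pos hβ)).hasDerivAt.comp_ofReal
  simp only [theta_eq]
  exact hd.const_mul _

theorem continuous_thetaDot {β : ℝ} (hβ : 0 < β) : Continuous (thetaDot β) := by
  have := continuous_deriv_thetaProd_right (ofReal_re_pos hβ)
  unfold thetaDot
  fun_prop

theorem thetaDot_eq {β : ℝ} (hβ : 0 < β) {r : ℂ} (hr : theta β r ≠ 0) :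
    thetaDot β r = dlogTheta β r * theta β r := by
  rw [theta_eq] at hr
  have hP := right_ne_zero_of_mul hr
  have hl := logDeriv_thetaProd_right hβ hP
  rw [logDeriv_apply, div_eq_iff hP] at hl
  rw [thetaDot, hl, theta_eq, dlogTheta]
  ring

/-! ### The potential as a Lambert series, and quasi-periodicity -/

theorem one_div_four_mul_sin_half_sq (z : ℂ) :
    1 / (4 * sin (z / 2) ^ 2) = -(exp (I * z) / (1 - exp (I * z)) ^ 2) := by
  have h1 : exp (I * z) = exp (z / 2 * I) ^ 2 := by rw [← exp_nat_mul]; ring_nf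
  have h2 : exp (-(z / 2) * I) = (exp (z / 2 * I))⁻¹ := by rw [neg_mul, exp_neg]
  have h0 := exp_ne_zero (z / 2 * I)
  have h3 : 4 * sin (z / 2) ^ 2
      = -((1 - exp (z / 2 * I) ^ 2) ^ 2 / exp (z / 2 * I) ^ 2) := by
    rw [sin, h2, div_pow, mul_pow, I_sq]
    generalize exp (z / 2 * I) = e at h0
    field_simp
    ring
  rw [h3, h1, div_neg, one_div_div]

theorem div_one_sub_sq_inv {t : ℂ} (ht : t ≠ 0) : t⁻¹ / (1 - t⁻¹) ^ 2 = t / (1 - t) ^ 2 := by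
  have h : (1 - t⁻¹) ^ 2 = (1 - t) ^ 2 / t ^ 2 := by
    field_simp
    ring
  rw [h, div_div_eq_mul_div]
  congr 1
  field_simp

/-- The sum over `ℤ` is split into zero, positive and negative indices. The negative ones are
brought to convergent form by the invariance of `t / (1 - t) ^ 2` under `t ↦ t⁻¹`. -/
theorem V_eq {β : ℝ} (hβ : 0 < β) (r : ℂ) :
    V β r = 1 / (4 * sin (r / 2) ^ 2) - lambertK (nomeSq β) (exp (I * r))
      - lambertK (nomeSq β) (exp (-(I * r))) := by
  have hu := norm_nomeSq_lt_one hβ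
  have hu0 := nomeSq_ne_zero β
  set f : ℤ → ℂ := fun m => 1 / (4 * sin ((r + I * β * m) / 2) ^ 2) with hf
  have hp : HasSum (fun m : ℕ => f ((m + 1 : ℕ) : ℤ)) (-lambertK (nomeSq β) (exp (I * r))) := by
    refine (summable_lambertK hu (exp (I * r))).hasSum.neg.congr_fun fun m => ?_
    rw [hf]
    beta_reduce
    rw [one_div_four_mul_sin_half_sq]
    have : exp (I * (r + I * β * (((m + 1 : ℕ) : ℤ) : ℂ))) = nomeSq β ^ (m + 1) * exp (I * r) := by
      rw [nomeSq, ← exp_nat_mul, ← exp_add]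
      congr 1
      push_cast
      linear_combination (β : ℂ) * (m + 1) * I_mul_I
    rw [this]
  have hn : HasSum (fun m : ℕ => f (-((m : ℤ) + 1))) (-lambertK (nomeSq β) (exp (-(I * r)))) := by
    refine (summable_lambertK hu (exp (-(I * r)))).hasSum.neg.congr_fun fun m => ?_
    rw [hf]
    beta_reduce
    rw [one_div_four_mul_sin_half_sq]
    have : exp (I * (r + I * β * ((-((m : ℤ) + 1) : ℤ) : ℂ)))
        = (nomeSq β ^ (m + 1) * exp (-(I * r)))⁻¹ := by
      rw [nomeSq, ← exp_nat_mul, ← exp_add, ← exp_neg]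
      congr 1
      push_cast
      linear_combination (-(β : ℂ) * (m + 1)) * I_mul_I
    rw [this, div_one_sub_sq_inv (mul_ne_zero (pow_ne_zero _ hu0) (exp_ne_zero _))]
  have hf0 : f ((0 : ℕ) : ℤ) = 1 / (4 * sin (r / 2) ^ 2) := by simp [hf]
  have h0 : HasSum (fun m : ℕ => f (m : ℤ))
      (1 / (4 * sin (r / 2) ^ 2) + -lambertK (nomeSq β) (exp (I * r))) := by
    rw [← hf0]
    exact HasSum.zero_add (f := fun m : ℕ => f (m : ℤ)) hp
  rw [V, (HasSum.of_nat_of_neg_add_one h0 hn).tsum_eq]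
  ring

theorem V_add_period (β : ℝ) (r : ℂ) : V β (r + I * β) = V β r := by
  rw [V, V, ← (Equiv.addRight (1 : ℤ)).tsum_eq
    (fun m : ℤ => 1 / (4 * sin ((r + I * β * m) / 2) ^ 2))]
  refine tsum_congr fun m => ?_
  simp only [Equiv.coe_addRight]
  push_cast
  ring_nf

theorem sin_half_add_two_pi (r : ℂ) : sin ((r + 2 * Real.pi) / 2) = -sin (r / 2) := by
  rw [show (r + 2 * Real.pi) / 2 = r / 2 + Real.pi by ring, sin_add_pi]

theorem cos_half_add_two_pi (r : ℂ) : cos ((r + 2 * Real.pi) / 2) = -cos (r / 2) := by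
  rw [show (r + 2 * Real.pi) / 2 = r / 2 + Real.pi by ring, cos_add_pi]

theorem V_add_two_pi (β : ℝ) (r : ℂ) : V β (r + 2 * Real.pi) = V β r := by
  rw [V, V]
  refine tsum_congr fun m => ?_
  rw [add_right_comm, sin_half_add_two_pi, neg_sq]

theorem V_neg (β : ℝ) (r : ℂ) : V β (-r) = V β r := by
  rw [V, V, ← (Equiv.neg ℤ).tsum_eq]
  refine tsum_congr fun m => ?_
  simp only [Equiv.neg_apply]
  rw [show (-r + I * β * ((-m : ℤ) : ℂ)) / 2 = -((r + I * β * m) / 2) by push_cast; ring, sin_neg,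
    neg_sq]

theorem phi_neg (β : ℝ) (r : ℂ) : phi β (-r) = -phi β r := by
  rw [phi, phi, neg_div, cos_neg, sin_neg, mul_neg, mul_neg, neg_neg, div_neg]
  ring

theorem phi_add_two_pi (β : ℝ) (r : ℂ) : phi β (r + 2 * Real.pi) = phi β r := by
  rw [phi, phi, exp_I_mul_add_two_pi, exp_neg_I_mul_add_two_pi, sin_half_add_two_pi,
    cos_half_add_two_pi, mul_neg, neg_div_neg_eq]

theorem dlogTheta_add_two_pi (β : ℝ) (r : ℂ) :
    dlogTheta β (r + 2 * Real.pi) = dlogTheta β r := by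
  rw [dlogTheta, dlogTheta, exp_I_mul_add_two_pi, exp_neg_I_mul_add_two_pi]

theorem theta_add_two_pi (β : ℝ) (r : ℂ) : theta β (r + 2 * Real.pi) = -theta β r := by
  rw [theta, theta, sin_half_add_two_pi, show cos (r + 2 * Real.pi) = cos r from cos_periodic r,
    neg_mul]

/-- The cotangent is, up to a constant, the missing term of index zero of `lambertS`; this lets the
shift by `iβ` telescope. -/
theorem cot_half_eq {z : ℂ} (hz : exp (I * z) ≠ 1) :
    cos (z / 2) / (2 * sin (z / 2)) = -(I / 2) - I * (exp (I * z) / (1 - exp (I * z))) := by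
  have hs := (sin_half_ne_zero_iff z).2 hz
  have h1 : exp (I * z) = exp (z / 2 * I) ^ 2 := by rw [← exp_nat_mul]; ring_nf
  have h2 : exp (-(z / 2) * I) = (exp (z / 2 * I))⁻¹ := by rw [neg_mul, exp_neg]
  have h0 := exp_ne_zero (z / 2 * I)
  rw [h1] at hz ⊢
  have hz' : 1 - exp (z / 2 * I) ^ 2 ≠ 0 := sub_ne_zero.2 hz.symm
  rw [div_eq_iff (mul_ne_zero two_ne_zero hs), sin, cos, h2]
  set e := exp (z / 2 * I)
  field_simp
  ring_nf
  simp only [I_sq]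
  ring

/-- One Lambert series loses a term and the other gains one. With the cotangent as term of index
zero everything telescopes, except for `t/(1-t) + t⁻¹/(1-t⁻¹) = -1`, the source of `-I`. -/
theorem phi_add_period {β : ℝ} (hβ : 0 < β) {r : ℂ} (hr : theta β r ≠ 0) :
    phi β (r + I * β) = phi β r - I := by
  have hr' := (theta_ne_zero_add_period hβ r).2 hr
  have hu := norm_nomeSq_lt_one hβ
  have e1 := (sin_half_ne_zero_iff _).1 ((theta_ne_zero_iff hβ _).1 hr').1
  have e0 := (sin_half_ne_zero_iff _).1 ((theta_ne_zero_iff hβ _).1 hr).1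
  have h1 := lambertS_mul hu (exp (I * r))
  have h2 := lambertS_mul hu (exp (-(I * (r + I * β))))
  rw [exp_neg_I_mul_add_period] at h2
  rw [phi, phi, cot_half_eq e1, cot_half_eq e0]
  rw [exp_I_mul_add_period] at e1 ⊢
  rw [h1, eq_add_of_sub_eq h2.symm]
  have h3 : exp (-(I * r)) = (exp (I * r))⁻¹ := exp_neg _
  have h0 := exp_ne_zero (I * r)
  have h4 : exp (-(I * r)) / (1 - exp (-(I * r))) = -1 - exp (I * r) / (1 - exp (I * r)) := by
    have e0'' : 1 - exp (I * r) ≠ 0 := sub_ne_zero.2 e0.symm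
    rw [h3]
    field_simp
    ring
  rw [h4]
  ring

/-- The shift of `lambertR` releases exactly the `lambertS` series out of which `phi` is built. -/
theorem dlogTheta_add_period {β : ℝ} (hβ : 0 < β) {r : ℂ} (hr : theta β r ≠ 0) :
    dlogTheta β (r + I * β) = dlogTheta β r - I * phi β r - 1 / 2 := by
  have hr' := (theta_ne_zero_add_period hβ r).2 hr
  have hu := norm_nomeSq_lt_one hβ
  have e0 := (sin_half_ne_zero_iff _).1 ((theta_ne_zero_iff hβ _).1 hr).1
  have h1 := lambertR_mul hu (exp (I * r))
  have h2 := lambertR_mul hu (exp (-(I * (r + I * β))))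
  have h3 := lambertS_mul hu (exp (-(I * (r + I * β))))
  rw [exp_neg_I_mul_add_period] at h2 h3
  have h5 : exp (-(I * r)) / (1 - exp (-(I * r))) = -1 - exp (I * r) / (1 - exp (I * r)) := by
    have e0'' : 1 - exp (I * r) ≠ 0 := sub_ne_zero.2 e0.symm
    have e0' : exp (I * r) - 1 ≠ 0 := sub_ne_zero.2 e0
    have h0 := exp_ne_zero (I * r)
    rw [exp_neg]
    field_simp
    ring
  rw [dlogTheta, dlogTheta, phi, cot_half_eq e0, exp_I_mul_add_period, h1,
    eq_add_of_sub_eq h2.symm, eq_add_of_sub_eq h3.symm, h5]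
  linear_combination (-(1 / 2) - exp (I * r) / (1 - exp (I * r))
    - lambertS (nomeSq β) (exp (I * r)) + lambertS (nomeSq β) (exp (-(I * r)))) * I_mul_I

/-! ### Derivatives of φ, `V` and ∂_β log θ in the position -/

theorem hasDerivAt_exp_I_mul (r : ℂ) :
    HasDerivAt (fun r => exp (I * r)) (exp (I * r) * I) r := by
  simpa using ((hasDerivAt_id r).const_mul I).cexp

theorem hasDerivAt_exp_neg_I_mul (r : ℂ) :
    HasDerivAt (fun r => exp (-(I * r))) (exp (-(I * r)) * (-I)) r := by
  simpa using ((hasDerivAt_id r).const_mul I).neg.cexp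

theorem hasDerivAt_lambertS_sub {β : ℝ} (hβ : 0 < β) {r : ℂ}
    (h1 : exp (I * r) ∈ lambertDomain (nomeSq β))
    (h2 : exp (-(I * r)) ∈ lambertDomain (nomeSq β)) :
    HasDerivAt (fun r => - I * lambertS (nomeSq β) (exp (I * r))
        + I * lambertS (nomeSq β) (exp (-(I * r))))
      (lambertK (nomeSq β) (exp (I * r)) + lambertK (nomeSq β) (exp (-(I * r)))) r := by
  have hu := norm_nomeSq_lt_one hβ
  have n1 := exp_ne_zero (I * r)
  have n2 := exp_ne_zero (-(I * r))
  have d1 := (HasDerivAt.comp r (hasDerivAt_lambertS hu h1 n1) (hasDerivAt_exp_I_mul r)).const_mul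
    (-I)
  have d2 := (HasDerivAt.comp r (hasDerivAt_lambertS hu h2 n2)
    (hasDerivAt_exp_neg_I_mul r)).const_mul I
  refine (d1.add d2).congr_deriv ?_
  field_simp
  linear_combination (-(lambertK (nomeSq β) (exp (I * r)))
    - lambertK (nomeSq β) (exp (-(I * r)))) * I_sq

theorem hasDerivAt_phi {β : ℝ} (hβ : 0 < β) {r : ℂ} (hr : theta β r ≠ 0) :
    HasDerivAt (phi β) (-V β r) r := by
  obtain ⟨hs, h1, h2⟩ := (theta_ne_zero_iff hβ r).1 hr
  have d0 := (hasDerivAt_half r).ccos.div ((hasDerivAt_half r).csin.const_mul 2)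
    (mul_ne_zero two_ne_zero hs)
  have d := d0.add (hasDerivAt_lambertS_sub hβ h1 h2)
  have hphi : phi β = fun r => cos (r / 2) / (2 * sin (r / 2)) +
      (-I * lambertS (nomeSq β) (exp (I * r)) + I * lambertS (nomeSq β) (exp (-(I * r)))) := by
    funext r
    rw [phi]
    ring
  rw [hphi]
  refine d.congr_deriv ?_
  rw [V_eq hβ]
  have hc : cos (r / 2) ^ 2 = 1 - sin (r / 2) ^ 2 := cos_sq' _
  field_simp
  linear_combination (-4 : ℂ) * hc

theorem differentiableAt_lambert_comp {β : ℝ} {g : ℂ → ℂ} {r : ℂ}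
    (hg : ∀ {x}, x ∈ lambertDomain (nomeSq β) → DifferentiableAt ℂ g x)
    (h1 : exp (I * r) ∈ lambertDomain (nomeSq β))
    (h2 : exp (-(I * r)) ∈ lambertDomain (nomeSq β)) :
    DifferentiableAt ℂ (fun r => g (exp (I * r)) + g (exp (-(I * r)))) r :=
  (DifferentiableAt.comp r (hg h1) (hasDerivAt_exp_I_mul r).differentiableAt).add
    (DifferentiableAt.comp r (hg h2) (hasDerivAt_exp_neg_I_mul r).differentiableAt)

theorem differentiableAt_dlogTheta {β : ℝ} (hβ : 0 < β) {r : ℂ} (hr : theta β r ≠ 0) :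
    DifferentiableAt ℂ (dlogTheta β) r :=
  differentiableAt_lambert_comp (differentiableAt_lambertR (norm_nomeSq_lt_one hβ))
    ((theta_ne_zero_iff hβ r).1 hr).2.1 ((theta_ne_zero_iff hβ r).1 hr).2.2

theorem differentiableAt_V {β : ℝ} (hβ : 0 < β) {r : ℂ} (hr : theta β r ≠ 0) :
    DifferentiableAt ℂ (V β) r := by
  obtain ⟨hs, h1, h2⟩ := (theta_ne_zero_iff hβ r).1 hr
  have hV : V β = fun r => 1 / (4 * sin (r / 2) ^ 2) -
      (lambertK (nomeSq β) (exp (I * r)) + lambertK (nomeSq β) (exp (-(I * r)))) := by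
    funext r
    rw [V_eq hβ]
    ring
  rw [hV]
  refine DifferentiableAt.sub ?_
    (differentiableAt_lambert_comp (differentiableAt_lambertK (norm_nomeSq_lt_one hβ)) h1 h2)
  have h4 : 4 * sin (r / 2) ^ 2 ≠ 0 := mul_ne_zero (by norm_num) (pow_ne_zero 2 hs)
  fun_prop (disch := exact h4)

/-! ### Isolated zeros and Liouville's theorem -/

/-- A witness that `θ` is not identically zero: `exp(iπ) = -1`, whereas all powers of `exp(-β)` are
positive. -/
theorem theta_pi_ne_zero {β : ℝ} (hβ : 0 < β) : theta β Real.pi ≠ 0 := by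
  have hpi : exp (I * Real.pi) = -1 := by rw [mul_comm, exp_pi_mul_I]
  rw [theta_ne_zero_iff_zpow hβ]
  intro n h
  rw [hpi, nomeSq, ← ofReal_neg, ← ofReal_exp, ← ofReal_zpow] at h
  have h2 : (Real.exp (-β)) ^ n = -1 := by
    have : (((Real.exp (-β)) ^ n * (-1) : ℝ) : ℂ) = ((1 : ℝ) : ℂ) := by
      push_cast at h ⊢
      exact h
    linarith [ofReal_injective this]
  linarith [zpow_pos (Real.exp_pos (-β)) n]

theorem eventually_theta_ne_zero {β : ℝ} (hβ : 0 < β) (p : ℂ) :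
    ∀ᶠ z in 𝓝[≠] p, theta β z ≠ 0 := by
  have han : AnalyticOnNhd ℂ (theta β) Set.univ := fun z _ =>
    (differentiable_theta hβ).analyticAt z
  rcases (han p trivial).eventually_eq_zero_or_eventually_ne_zero with h | h
  · exact absurd (han.eqOn_zero_of_preconnected_of_eventuallyEq_zero isPreconnected_univ
      (Set.mem_univ p) h (Set.mem_univ (Real.pi : ℂ))) (theta_pi_ne_zero hβ)
  · exact h

/-- Every point can be translated into a fixed compact set by a period. -/
theorem exists_period_translate {β : ℝ} (hβ : 0 < β) (z : ℂ) :
    ∃ a b : ℤ, z + a * (2 * Real.pi) + b * (I * β) ∈ Set.Icc 0 (2 * Real.pi) ×ℂ Set.Icc 0 β := by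
  refine ⟨-⌊z.re / (2 * Real.pi)⌋, -⌊z.im / β⌋, ?_⟩
  have h2 : (0 : ℝ) < 2 * Real.pi := by positivity
  have hfr : ∀ {x T : ℝ}, 0 < T → x + -(⌊x / T⌋ : ℝ) * T ∈ Set.Icc 0 T := by
    intro x T hT
    have h3 := Int.floor_le (x / T)
    have h4 := (Int.lt_floor_add_one (x / T)).le
    rw [le_div_iff₀ hT] at h3
    rw [div_le_iff₀ hT] at h4
    constructor <;> nlinarith
  rw [mem_reProdIm]
  constructor
  · convert! hfr (x := z.re) h2 using 1
    simp
  · convert! hfr (x := z.im) hβ using 1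
    simp

/-- A doubly periodic function, holomorphic off a discrete set of removable singularities at which
it has the limit `ℓ`, is equal to `ℓ`, provided there is at least one such singularity. -/
theorem eq_of_doubly_periodic {β : ℝ} (hβ : 0 < β) {f : ℂ → ℂ} {good : ℂ → Prop} {ℓ : ℂ}
    (hg1 : ∀ z, good (z + 2 * Real.pi) ↔ good z) (hg2 : ∀ z, good (z + I * β) ↔ good z)
    (hf1 : ∀ z, good z → f (z + 2 * Real.pi) = f z) (hf2 : ∀ z, good z → f (z + I * β) = f z)
    (hd : ∀ z, good z → DifferentiableAt ℂ f z)
    (hev : ∀ p, ∀ᶠ z in 𝓝[≠] p, good z)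
    (hbad : ∃ p, ¬good p)
    (hlim : ∀ p, ¬good p → ∃ a b : ℤ,
      Tendsto f (𝓝[≠] (p + a * (2 * Real.pi) + b * (I * β))) (𝓝 ℓ))
    {z : ℂ} (hz : good z) : f z = ℓ := by
  classical
  -- Filling the singularities with `ℓ` will give an entire doubly periodic function. It is bounded
  -- by its values on one period rectangle, hence constant.
  set g : ℂ → ℂ := fun z => if good z then f z else ℓ with hgdef
  have gp1 : Function.Periodic g (2 * Real.pi) := by
    intro z
    simp only [hgdef, hg1]
    split_ifs with h
    · exact hf1 z h
    · rfl
  have gp2 : Function.Periodic g (I * β) := by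
    intro z
    simp only [hgdef, hg2]
    split_ifs with h
    · exact hf2 z h
    · rfl
  have goodp1 : Function.Periodic good (2 * Real.pi) := fun z => propext (hg1 z)
  have goodp2 : Function.Periodic good (I * β) := fun z => propext (hg2 z)
  have gtrans : ∀ (a b : ℤ) z, g (z + a * (2 * Real.pi) + b * (I * β)) = g z := fun a b z => by
    rw [gp2.int_mul b, gp1.int_mul a]
  have goodtrans : ∀ (a b : ℤ) z, good (z + a * (2 * Real.pi) + b * (I * β)) = good z :=
    fun a b z => by rw [goodp2.int_mul b, goodp1.int_mul a]
  have hopen : ∀ z, good z → ∀ᶠ y in 𝓝 z, good y := fun z hz => by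
    rw [← nhdsNE_sup_pure z]
    exact eventually_sup.2 ⟨hev z, by simpa using hz⟩
  have hdiffgood : ∀ z, good z → DifferentiableAt ℂ g z := fun z hz => by
    refine (hd z hz).congr_of_eventuallyEq ?_
    filter_upwards [hopen z hz] with y hy
    simp [hgdef, hy]
  have hdiff : Differentiable ℂ g := by
    intro p
    by_cases hp : good p
    · exact hdiffgood p hp
    · obtain ⟨a, b, hab⟩ := hlim p hp
      set p' := p + a * (2 * Real.pi) + b * (I * β) with hp'
      have hbadp' : ¬good p' := by rwa [hp', goodtrans]
      have hc : ContinuousAt g p' := by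
        rw [continuousAt_iff_punctured_nhds]
        have : g p' = ℓ := by simp [hgdef, hbadp']
        rw [this]
        refine hab.congr' ?_
        filter_upwards [hev p'] with y hy
        simp [hgdef, hy]
      have han := (analyticAt_of_differentiable_on_punctured_nhds_of_continuousAt
        ((hev p').mono hdiffgood) hc).differentiableAt
      -- The limit is known only at the translate `p'`; periodicity carries differentiability back
      -- to `p`.
      have hcomp : g = fun z => g (z + a * (2 * Real.pi) + b * (I * β)) :=
        funext fun z => (gtrans a b z).symm
      rw [hcomp]
      exact DifferentiableAt.comp p (g := g) han (by fun_prop)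
  have hbdd : Bornology.IsBounded (Set.range g) := by
    have hK : IsCompact (Set.Icc 0 (2 * Real.pi) ×ℂ Set.Icc 0 β) :=
      isCompact_Icc.reProdIm isCompact_Icc
    refine (hK.image hdiff.continuous).isBounded.subset ?_
    rintro _ ⟨z, rfl⟩
    obtain ⟨a, b, hab⟩ := exists_period_translate hβ z
    exact ⟨_, hab, gtrans a b z⟩
  obtain ⟨p, hp⟩ := hbad
  have h := hdiff.apply_eq_apply_of_bounded hbdd z p
  simpa [hgdef, hz, hp] using h

/-! ### Behaviour at the origin -/

theorem theta_eq_zero_iff {β : ℝ} (hβ : 0 < β) (p : ℂ) :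
    theta β p = 0 ↔ ∃ a b : ℤ, p + a * (2 * Real.pi) + b * (I * β) = 0 := by
  have h := theta_ne_zero_iff_zpow hβ p
  rw [← not_iff_not, ← Ne, h, ← not_exists, not_iff_not, exists_comm]
  refine exists_congr fun n => ?_
  rw [nomeSq, ← exp_int_mul, ← exp_add, exp_eq_one_iff]
  constructor
  · rintro ⟨k, hk⟩
    refine ⟨-k, ?_⟩
    push_cast
    linear_combination (-I) * hk + (p + (-k : ℂ) * (2 * Real.pi)) * I_mul_I
  · rintro ⟨k, hk⟩
    refine ⟨-k, ?_⟩
    push_cast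
    linear_combination I * hk - (n * β : ℂ) * I_mul_I

theorem theta_zero (β : ℝ) : theta β 0 = 0 := by
  simp [theta]

theorem c0_eq {β : ℝ} (hβ : 0 < β) : (c0 β : ℂ) = 1 / 12 - 2 * lambertK (nomeSq β) 1 := by
  have hu := norm_nomeSq_lt_one hβ
  have h : ∀ m : ℕ, ((1 / (2 * Real.sinh (β * ((m : ℝ) + 1) / 2) ^ 2) : ℝ) : ℂ)
      = 2 * (nomeSq β ^ (m + 1) * 1 / (1 - nomeSq β ^ (m + 1) * 1) ^ 2) := by
    intro m
    have h1 := one_div_four_mul_sin_half_sq (I * (β * (m + 1)))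
    have h2 : sin (I * (β * (m + 1)) / 2) ^ 2 = -sinh (β * (m + 1) / 2) ^ 2 := by
      rw [show I * ((β : ℂ) * (m + 1)) / 2 = (β * (m + 1) / 2) * I by ring, sin_mul_I, mul_pow,
        I_sq]
      ring
    have h3 : exp (I * (I * (β * (m + 1)))) = nomeSq β ^ (m + 1) := by
      rw [← exp_neg_mul_succ]
      congr 1
      linear_combination (β : ℂ) * (m + 1) * I_mul_I
    rw [h2, h3, mul_neg, div_neg, neg_inj] at h1
    rw [mul_one, ← h1]
    push_cast
    ring
  have hs := (summable_lambertK hu 1).hasSum.mul_left 2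
  rw [c0, c1]
  push_cast at h ⊢
  rw [tsum_congr h, hs.tsum_eq, lambertK]

/-- The part of `φ` that is regular at the origin. -/
def phiReg (β : ℝ) (r : ℂ) : ℂ :=
  - I * lambertS (nomeSq β) (exp (I * r)) + I * lambertS (nomeSq β) (exp (-(I * r)))

theorem phi_eq (β : ℝ) (r : ℂ) : phi β r = cos (r / 2) / (2 * sin (r / 2)) + phiReg β r := by
  rw [phi, phiReg]
  ring

theorem phiReg_zero (β : ℝ) : phiReg β 0 = 0 := by simp [phiReg]

theorem exp_zero_mem_lambertDomain {β : ℝ} (hβ : 0 < β) :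
    exp (I * 0) ∈ lambertDomain (nomeSq β) ∧ exp (-(I * 0)) ∈ lambertDomain (nomeSq β) := by
  have := one_mem_lambertDomain (norm_nomeSq_lt_one hβ)
  simpa using this

theorem hasDerivAt_phiReg {β : ℝ} (hβ : 0 < β) :
    HasDerivAt (phiReg β) (2 * lambertK (nomeSq β) 1) 0 := by
  obtain ⟨h1, h2⟩ := exp_zero_mem_lambertDomain hβ
  refine (hasDerivAt_lambertS_sub hβ h1 h2).congr_deriv ?_
  simp [two_mul]

theorem tendsto_div_self {δ : ℂ → ℂ} {d : ℂ} (h : HasDerivAt δ d 0) (h0 : δ 0 = 0) :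
    Tendsto (fun r => δ r / r) (𝓝[≠] 0) (𝓝 d) := by
  have := hasDerivAt_iff_tendsto_slope_zero.1 h
  refine this.congr fun r => ?_
  simp [h0, div_eq_inv_mul]

/-- Half the cotangent of `r/2` has a simple pole of residue `1`, so multiplying by a function
vanishing at `0` picks out its derivative. -/
theorem tendsto_cot_mul {δ : ℂ → ℂ} {d : ℂ} (h : HasDerivAt δ d 0) (h0 : δ 0 = 0) :
    Tendsto (fun r => cos (r / 2) / (2 * sin (r / 2)) * δ r) (𝓝[≠] 0) (𝓝 d) := by
  have hs : HasDerivAt (fun r : ℂ => 2 * sin (r / 2)) 1 0 := by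
    refine ((hasDerivAt_half 0).csin.const_mul 2).congr_deriv ?_
    simp
  have h1 := tendsto_div_self hs (by simp)
  have h2 := tendsto_div_self h h0
  have h3 : Tendsto (fun r : ℂ => cos (r / 2)) (𝓝[≠] 0) (𝓝 1) := by
    have : ContinuousAt (fun r : ℂ => cos (r / 2)) 0 := by fun_prop
    have h4 := this.tendsto.mono_left (nhdsWithin_le_nhds (s := {0}ᶜ))
    simpa using h4
  have h5 := (h3.mul h2).div h1 one_ne_zero
  rw [one_mul, div_one] at h5
  refine h5.congr' ?_
  filter_upwards [self_mem_nhdsWithin] with r hr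
  have hr' : r ≠ 0 := hr
  simp only [Pi.div_apply]
  rw [div_div_eq_mul_div, mul_assoc, div_mul_cancel₀ _ hr']
  ring

theorem tendsto_phi_mul {β : ℝ} (hβ : 0 < β) {δ : ℂ → ℂ} {d : ℂ} (h : HasDerivAt δ d 0)
    (h0 : δ 0 = 0) : Tendsto (fun r => phi β r * δ r) (𝓝[≠] 0) (𝓝 d) := by
  have hc : ContinuousAt (fun r => phiReg β r * δ r) 0 :=
    (hasDerivAt_phiReg hβ).continuousAt.mul h.continuousAt
  have h1 := (tendsto_cot_mul h h0).add
    (hc.tendsto.mono_left (nhdsWithin_le_nhds (s := {0}ᶜ)))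
  rw [h0, mul_zero, add_zero] at h1
  refine h1.congr fun r => ?_
  rw [phi_eq]
  ring

/-- The double poles cancel through `1/sin² = 1 + cot²`. There remains `1/4 - 2K - 4K` with `K =
lambertK u 1`, `u = nomeSq β`: `-2K` from `V`, and `-4K` from the cross term of the pole of `phi`
with `phiReg`. -/
theorem tendsto_V_sub_phi_sq {β : ℝ} (hβ : 0 < β) :
    Tendsto (fun r => V β r - phi β r ^ 2) (𝓝[≠] 0) (𝓝 (3 * c0 β)) := by
  obtain ⟨hd1, hd2⟩ := exp_zero_mem_lambertDomain hβ
  have hu := norm_nomeSq_lt_one hβ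
  have h1 := tendsto_cot_mul (hasDerivAt_phiReg hβ) (phiReg_zero β)
  have hc : ContinuousAt (fun r => 1 / 4 - phiReg β r ^ 2 - (lambertK (nomeSq β) (exp (I * r))
      + lambertK (nomeSq β) (exp (-(I * r))))) 0 :=
    (continuousAt_const.sub ((hasDerivAt_phiReg hβ).continuousAt.pow 2)).sub
      (differentiableAt_lambert_comp (differentiableAt_lambertK hu) hd1 hd2).continuousAt
  have h2 := (hc.tendsto.mono_left (nhdsWithin_le_nhds (s := {0}ᶜ))).sub (h1.const_mul 2)
  have hval : 1 / 4 - phiReg β 0 ^ 2 - (lambertK (nomeSq β) (exp (I * 0))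
      + lambertK (nomeSq β) (exp (-(I * 0)))) - 2 * (2 * lambertK (nomeSq β) 1)
      = 3 * (c0 β : ℂ) := by
    rw [c0_eq hβ, phiReg_zero]
    simp only [mul_zero, neg_zero, exp_zero]
    ring
  rw [hval] at h2
  refine h2.congr' ?_
  filter_upwards [eventually_theta_ne_zero hβ 0] with r hr
  have hs := ((theta_ne_zero_iff hβ r).1 hr).1
  rw [V_eq hβ, phi_eq]
  have hcs : cos (r / 2) ^ 2 = 1 - sin (r / 2) ^ 2 := cos_sq' _
  have h3 : 1 / (4 * sin (r / 2) ^ 2) = 1 / 4 + (cos (r / 2) / (2 * sin (r / 2))) ^ 2 := by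
    rw [div_pow, mul_pow, hcs]
    field_simp
    ring
  rw [h3]
  ring

/-! ### Heat equation and addition theorem -/

/-- The logarithmic form of the heat equation for `θ`. -/
theorem two_mul_dlogTheta {β : ℝ} (hβ : 0 < β) {r : ℂ} (hr : theta β r ≠ 0) :
    2 * dlogTheta β r = -V β r + phi β r ^ 2 + c0 β + 2 * c1 := by
  have hu := norm_nomeSq_lt_one hβ
  have key : 2 * dlogTheta β r + (V β r - phi β r ^ 2) = c0 β + 1 / 6 := by
    refine eq_of_doubly_periodic hβ (f := fun r => 2 * dlogTheta β r + (V β r - phi β r ^ 2))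
      (good := fun r => theta β r ≠ 0) ?_ (theta_ne_zero_add_period hβ) ?_ ?_ ?_
      (eventually_theta_ne_zero hβ) ⟨0, by simp [theta_zero]⟩ ?_ hr
    · intro z
      rw [theta_add_two_pi, neg_ne_zero]
    · intro z _
      rw [dlogTheta_add_two_pi, V_add_two_pi, phi_add_two_pi]
    · intro z hz
      -- Under `iβ` both `2 * dlogTheta` and `phi ^ 2` change by `-2iφ - 1`, so the defects cancel.
      rw [dlogTheta_add_period hβ hz, V_add_period, phi_add_period hβ hz]
      linear_combination -I_sq
    · intro z hz
      exact ((differentiableAt_dlogTheta hβ hz).const_mul 2).add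
        ((differentiableAt_V hβ hz).sub ((hasDerivAt_phi hβ hz).differentiableAt.pow 2))
    · intro p hp
      obtain ⟨a, b, hab⟩ := (theta_eq_zero_iff hβ p).1 (not_not.1 hp)
      refine ⟨a, b, ?_⟩
      rw [hab]
      obtain ⟨hd1, hd2⟩ := exp_zero_mem_lambertDomain hβ
      have hc : ContinuousAt (fun r => 2 * dlogTheta β r) 0 :=
        (differentiableAt_lambert_comp (differentiableAt_lambertR hu) hd1 hd2).continuousAt.const_mul
          2
      have h := (hc.tendsto.mono_left (nhdsWithin_le_nhds (s := {0}ᶜ))).add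
        (tendsto_V_sub_phi_sq hβ)
      -- By `lambertR_one` the first term is `4 * lambertK u 1` with `u = nomeSq β`, which equals
      -- `1/6 - 2 * c0`.
      have hval : 2 * dlogTheta β 0 + 3 * (c0 β : ℂ) = c0 β + 1 / 6 := by
        rw [c0_eq hβ, dlogTheta]
        simp only [mul_zero, neg_zero, exp_zero]
        rw [lambertR_one hu]
        ring
      rwa [hval] at h
  rw [c1]
  push_cast
  linear_combination key

/-- For fixed `y` the shifts by `-I` of `phi x` and `phi (x + y)` cancel, so the difference of the
two sides is elliptic in `x`. Its only possible singularities are at `x = 0` and `x = -y` modulo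
periods, and the symmetry `x ↦ -x - y` interchanges them. One limit at the origin therefore
suffices. -/
theorem phi_add_sq_aux {β : ℝ} (hβ : 0 < β) {x y : ℂ} (hx : theta β x ≠ 0) (hy : theta β y ≠ 0)
    (hxy : theta β (x + y) ≠ 0) :
    (phi β x + phi β y - phi β (x + y)) ^ 2 = V β x + V β y + V β (x + y) - 3 * c0 β := by
  set f : ℂ → ℂ := fun x => (phi β x + phi β y - phi β (x + y)) ^ 2
    - (V β x + V β y + V β (x + y)) + 3 * c0 β with hf
  have hsymm : ∀ x, f (-x - y) = f x := by
    intro x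
    simp only [hf]
    rw [show -x - y = -(x + y) by ring, show -(x + y) + y = -x by ring, phi_neg, phi_neg, V_neg,
      V_neg]
    ring
  have hlim0 : Tendsto f (𝓝[≠] 0) (𝓝 0) := by
    have hy0 : theta β (0 + y) ≠ 0 := by rwa [zero_add]
    -- Expanding the square, the cross term is `2 * phi x` times this function, which vanishes at
    -- `0`; its limit is `2 * V β y`.
    have hd : HasDerivAt (fun x => phi β y - phi β (x + y)) (V β y) 0 := by
      have h := ((hasDerivAt_phi hβ hy0).comp_add_const 0 y).const_sub (phi β y)
      rw [zero_add, neg_neg] at h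
      exact h
    have h1 := tendsto_phi_mul hβ hd (by simp)
    have hV : ContinuousAt (fun x => V β (x + y)) 0 :=
      ContinuousAt.comp (g := V β) (differentiableAt_V hβ hy0).continuousAt (by fun_prop)
    have hc : ContinuousAt (fun x => (phi β y - phi β (x + y)) ^ 2 - V β y - V β (x + y)
        + 3 * c0 β) 0 :=
      (((hd.continuousAt.pow 2).sub continuousAt_const).sub hV).add continuousAt_const
    have h2 := ((hc.tendsto.mono_left (nhdsWithin_le_nhds (s := {0}ᶜ))).add
      (h1.const_mul 2)).sub (tendsto_V_sub_phi_sq hβ)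
    have hval : (phi β y - phi β (0 + y)) ^ 2 - V β y - V β (0 + y) + 3 * c0 β + 2 * V β y
        - 3 * c0 β = 0 := by
      rw [zero_add]
      ring
    rw [hval] at h2
    refine h2.congr fun x => ?_
    simp only [hf]
    ring
  have hlimy : Tendsto f (𝓝[≠] (-y)) (𝓝 0) := by
    have ht : Tendsto (fun x => -x - y) (𝓝[≠] (-y)) (𝓝[≠] 0) := by
      refine tendsto_nhdsWithin_of_tendsto_nhds_of_eventually_within _ ?_ ?_
      · have : ContinuousAt (fun x => -x - y) (-y) := by fun_prop
        have h := this.tendsto.mono_left (nhdsWithin_le_nhds (s := {-y}ᶜ))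
        simpa using h
      · filter_upwards [self_mem_nhdsWithin] with x hx h0
        apply hx
        have h0' : -x - y = 0 := h0
        show x = -y
        linear_combination -h0'
    exact (hlim0.comp ht).congr hsymm
  have key : f x = 0 := by
    refine eq_of_doubly_periodic hβ (f := f)
      (good := fun x => theta β x ≠ 0 ∧ theta β (x + y) ≠ 0) ?_ ?_ ?_ ?_ ?_ ?_
      ⟨0, by simp [theta_zero]⟩ ?_ ⟨hx, hxy⟩
    · intro z
      rw [add_right_comm, theta_add_two_pi, theta_add_two_pi, neg_ne_zero, neg_ne_zero]
    · intro z
      rw [add_right_comm, theta_ne_zero_add_period hβ, theta_ne_zero_add_period hβ]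
    · intro z _
      simp only [hf]
      rw [add_right_comm, phi_add_two_pi, phi_add_two_pi, V_add_two_pi, V_add_two_pi]
    · rintro z ⟨hz1, hz2⟩
      simp only [hf]
      rw [add_right_comm, phi_add_period hβ hz1, phi_add_period hβ hz2, V_add_period, V_add_period]
      ring
    · rintro z ⟨hz1, hz2⟩
      have d1 := (hasDerivAt_phi hβ hz1).differentiableAt
      have d2 : DifferentiableAt ℂ (fun x => phi β (x + y)) z :=
        ((hasDerivAt_phi hβ hz2).comp_add_const z y).differentiableAt
      have d3 := differentiableAt_V hβ hz1
      have d4 : DifferentiableAt ℂ (fun x => V β (x + y)) z :=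
        ((differentiableAt_V hβ hz2).hasDerivAt.comp_add_const z y).differentiableAt
      simp only [hf]
      fun_prop
    · intro p
      refine (eventually_theta_ne_zero hβ p).and ?_
      have ht : Tendsto (fun x => x + y) (𝓝[≠] p) (𝓝[≠] (p + y)) := by
        refine tendsto_nhdsWithin_of_tendsto_nhds_of_eventually_within _ ?_ ?_
        · have : ContinuousAt (fun x => x + y) p := by fun_prop
          exact this.tendsto.mono_left nhdsWithin_le_nhds
        · filter_upwards [self_mem_nhdsWithin] with x hx h0
          exact hx (add_right_cancel h0)
      exact ht.eventually (eventually_theta_ne_zero hβ (p + y))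
    · intro p hp
      by_cases h1 : theta β p = 0
      · obtain ⟨a, b, hab⟩ := (theta_eq_zero_iff hβ p).1 h1
        exact ⟨a, b, by rwa [hab]⟩
      · have h2 : theta β (p + y) = 0 := by
          by_contra h
          exact hp ⟨h1, h⟩
        obtain ⟨a, b, hab⟩ := (theta_eq_zero_iff hβ _).1 h2
        refine ⟨a, b, ?_⟩
        rwa [show p + a * (2 * Real.pi) + b * (I * β) = -y by linear_combination hab]
  simp only [hf] at key
  linear_combination key

/-- The addition theorem for `φ`. -/
theorem phi_add_add_sq {β : ℝ} (hβ : 0 < β) {x y z : ℂ} (hxyz : x + y + z = 0)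
    (hx : theta β x ≠ 0) (hy : theta β y ≠ 0) (hz : theta β z ≠ 0) :
    (phi β x + phi β y + phi β z) ^ 2 = V β x + V β y + V β z - 3 * c0 β := by
  have hz' : z = -(x + y) := by linear_combination hxyz
  have hxy : theta β (x + y) ≠ 0 := by
    have := theta_neg_ne_zero hz
    rwa [hz', neg_neg] at this
  rw [hz', phi_neg, V_neg, ← sub_eq_add_neg]
  exact phi_add_sq_aux hβ hx hy hxy

/-! ### Summation over pairs and triples of particles -/

section Algebra

variable {ι : Type*} [Fintype ι]

theorem sum_weighted_sq (m : ι → ℂ) (p : ι → ι → ℂ) :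
    ∑ J, m J * (∑ K, m K * p J K) ^ 2 = ∑ J, ∑ K, ∑ L, m J * m K * m L * (p J K * p J L) := by
  refine Finset.sum_congr rfl fun J _ => ?_
  rw [sq, Finset.sum_mul_sum, Finset.mul_sum]
  refine Finset.sum_congr rfl fun K _ => ?_
  rw [Finset.mul_sum]
  exact Finset.sum_congr rfl fun L _ => by ring

theorem sum_triple_rotate (f : ι → ι → ι → ℂ) :
    ∑ J, ∑ K, ∑ L, f K L J = ∑ J, ∑ K, ∑ L, f J K L := by
  rw [Finset.sum_comm]
  refine Finset.sum_congr rfl fun K _ => ?_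
  rw [Finset.sum_comm]

theorem sum_triple_pair (m : ι → ℂ) (f : ι → ι → ℂ) :
    ∑ J, ∑ K, ∑ L, m J * m K * m L * f J K = (∑ J, m J) * ∑ J, ∑ K, m J * m K * f J K := by
  rw [mul_comm, Finset.sum_mul]
  refine Finset.sum_congr rfl fun J _ => ?_
  rw [Finset.sum_mul]
  refine Finset.sum_congr rfl fun K _ => ?_
  rw [Finset.mul_sum]
  exact Finset.sum_congr rfl fun L _ => by ring

theorem sum_triple_diag [DecidableEq ι] (m : ι → ℂ) (f : ι → ι → ℂ) :
    ∑ J, ∑ K, ∑ L, m J * m K * m L * (if J = K then f J L else 0)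
      = ∑ J, ∑ L, m J ^ 2 * m L * f J L := by
  refine Finset.sum_congr rfl fun J _ => ?_
  rw [Finset.sum_comm]
  refine Finset.sum_congr rfl fun L _ => ?_
  simp only [mul_ite, mul_zero, Finset.sum_ite_eq, Finset.mem_univ, if_true]
  ring

/-- Summation of the three-term identity over all triples of particles. -/
theorem sum_weighted_sq_eq [DecidableEq ι] {m : ι → ℂ} {p W : ι → ι → ℂ} {c : ℂ}
    (hp : ∀ J K, p J K = -p K J) (hW : ∀ J K, W J K = W K J) (hW0 : ∀ J, W J J = 0)
    (h3 : ∀ J K L, J ≠ K → K ≠ L → L ≠ J →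
      (p J K + p K L + p L J) ^ 2 = W J K + W K L + W L J - 3 * c) :
    ∑ J, m J * (∑ K, m K * p J K) ^ 2
      = -(1 / 2) * (∑ J, m J) * ∑ J, ∑ K, m J * m K * (W J K - p J K ^ 2)
        + 1 / 2 * c * (∑ J, m J) ^ 3 + ∑ J, ∑ K, m J ^ 2 * m K * W J K
        - 3 / 2 * c * (∑ J, m J) * (∑ J, m J ^ 2) + c * ∑ J, m J ^ 3 := by
  have hp0 : ∀ J, p J J = 0 := fun J => by
    have := hp J J
    linear_combination this / 2
  set f : ι → ι → ι → ℂ := fun J K L => m J * m K * m L * (p J K * p J L) with hf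
  set g : ι → ι → ι → ℂ := fun J K L =>
    m J * m K * m L * (c / 2 - (W J K - p J K ^ 2) / 2)
      + m J * m K * m L * (if J = K then W J L - 3 / 2 * c else 0)
      + m J * m K * m L * (if J = K then (if J = L then c else 0) else 0) with hg
  have hpt : ∀ J K L, f J K L + f K L J + f L J K = g J K L + g K L J + g L J K := by
    intro J K L
    simp only [hf, hg]
    have e1 := hp K J
    have e2 := hp L K
    have e3 := hp L J
    by_cases hJK : J = K
    · subst hJK
      by_cases hJL : J = L
      · subst hJL
        simp only [hp0, hW0, if_true]
        ring
      · have hLJ : ¬ L = J := fun h => hJL h.symm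
        simp only [hp0, hW0, hJL, hLJ, if_true, if_false, e2, hW L J]
        ring
    · have hKJ : ¬ K = J := fun h => hJK h.symm
      by_cases hKL : K = L
      · subst hKL
        simp only [hp0, hW0, hJK, hKJ, if_true, if_false, e1, hW K J]
        ring
      · have hLK : ¬ L = K := fun h => hKL h.symm
        by_cases hLJ : L = J
        · subst hLJ
          simp only [hp0, hW0, hLK, hKL, if_true, if_false, e1, hW K L]
          ring
        · have h := h3 J K L hJK hKL hLJ
          simp only [hJK, hKL, hLJ, if_false, e1, e2]
          rw [e3] at h ⊢
          rw [hp J L] at *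
          linear_combination (m J * m K * m L / 2) * (-h)
  have hsum : ∑ J, ∑ K, ∑ L, f J K L = ∑ J, ∑ K, ∑ L, g J K L := by
    have h1 := sum_triple_rotate f
    have h2 := sum_triple_rotate fun J K L => f K L J
    have h1' := sum_triple_rotate g
    have h2' := sum_triple_rotate fun J K L => g K L J
    have htot : ∑ J, ∑ K, ∑ L, (f J K L + f K L J + f L J K)
        = ∑ J, ∑ K, ∑ L, (g J K L + g K L J + g L J K) := by simp only [hpt]
    simp only [Finset.sum_add_distrib] at htot
    beta_reduce at h2 h2'
    rw [h1, h2, h1, h1', h2', h1'] at htot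
    linear_combination htot / 3
  have hcube : (∑ J, m J) ^ 3 = (∑ J, m J) * ∑ J, ∑ K, m J * m K := by
    rw [← Finset.sum_mul_sum]
    ring
  have hprod : (∑ J, m J) * (∑ J, m J ^ 2) = ∑ J, ∑ K, m J ^ 2 * m K := by
    rw [mul_comm, Finset.sum_mul_sum]
  have hdd : ∑ J, ∑ L, m J ^ 2 * m L * (if J = L then c else 0) = c * ∑ J, m J ^ 3 := by
    rw [Finset.mul_sum]
    refine Finset.sum_congr rfl fun J _ => ?_
    simp only [mul_ite, mul_zero, Finset.sum_ite_eq, Finset.mem_univ, if_true]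
    ring
  have e1 : ∑ J, ∑ K, m J * m K * (c / 2 - (W J K - p J K ^ 2) / 2)
      = c / 2 * ∑ J, ∑ K, m J * m K - 1 / 2 * ∑ J, ∑ K, m J * m K * (W J K - p J K ^ 2) := by
    simp only [Finset.mul_sum, ← Finset.sum_sub_distrib]
    exact Finset.sum_congr rfl fun J _ => Finset.sum_congr rfl fun K _ => by ring
  have e2 : ∑ J, ∑ K, m J ^ 2 * m K * (W J K - 3 / 2 * c)
      = ∑ J, ∑ K, m J ^ 2 * m K * W J K - 3 / 2 * c * ∑ J, ∑ K, m J ^ 2 * m K := by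
    simp only [Finset.mul_sum, ← Finset.sum_sub_distrib]
    exact Finset.sum_congr rfl fun J _ => Finset.sum_congr rfl fun K _ => by ring
  rw [sum_weighted_sq]
  refine hsum.trans ?_
  simp only [hg, Finset.sum_add_distrib]
  rw [sum_triple_pair m fun J K => c / 2 - (W J K - p J K ^ 2) / 2,
    sum_triple_diag m fun J L => W J L - 3 / 2 * c,
    sum_triple_diag m fun J L => if J = L then c else 0, hdd, e1, e2, hcube, ← hprod]
  ring

theorem sum_antisymm_eq_zero {f : ι → ι → ℂ} (hf : ∀ J K, f J K = -f K J) :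
    ∑ J, ∑ K, f J K = 0 := by
  have h1 : ∑ J, ∑ K, f J K = ∑ J, ∑ K, f K J := Finset.sum_comm
  have h2 : ∑ J, ∑ K, f J K = -∑ J, ∑ K, f K J := by
    simp only [← Finset.sum_neg_distrib, ← hf]
  linear_combination (h1 + h2) / 2

/-- The algebraic core of the source identity: `lam * m J * ∑ K, m K * p J K + w * m J` is the
logarithmic derivative with respect to the position of particle `J`. -/
theorem source_identity_algebra [DecidableEq ι] {m : ι → ℂ} (hm : ∀ J, m J ≠ 0) {p W Λ e : ι → ι → ℂ}
    {c d lam w : ℂ}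
    (hp : ∀ J K, p J K = -p K J) (hW : ∀ J K, W J K = W K J) (hW0 : ∀ J, W J J = 0)
    (h3 : ∀ J K L, J ≠ K → K ≠ L → L ≠ J →
      (p J K + p K L + p L J) ^ 2 = W J K + W K L + W L J - 3 * c)
    (hΛ : ∀ J K, J ≠ K → 2 * Λ J K = -W J K + p J K ^ 2 + c + 2 * d)
    (he : ∀ J K, J ≠ K → e J K + e K J = lam * (m J * m K)) (he0 : ∀ J, e J J = 0) :
    ∑ J, (-1 / m J) * ((lam * (m J * ∑ K, m K * p J K) + w * m J) ^ 2
        - lam * (m J * ∑ K, m K * W J K))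
      + 1 / 2 * ∑ J, ∑ K, (-lam * (m J + m K) * (1 - lam * (m J * m K))) * W J K
      + 2 * lam * (∑ J, m J) * ∑ J, ∑ K, e J K * Λ J K
      - (lam ^ 2 * c * ((∑ J, m J) * (∑ J, m J ^ 2) - ∑ J, m J ^ 3)
        + lam ^ 2 * d * ((∑ J, m J) ^ 3 - (∑ J, m J) * (∑ J, m J ^ 2))
        - (∑ J, m J) * w ^ 2) = 0 := by
  have hp0 : ∀ J, p J J = 0 := fun J => by
    have := hp J J
    linear_combination this / 2
  have hT := sum_weighted_sq_eq (m := m) hp hW hW0 h3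
  -- The weight `-1 / m J` reduces the squared factor `m J ^ 2` to one `m J`, as required by the
  -- symmetric triple sum.
  have hkin : ∑ J, (-1 / m J) * ((lam * (m J * ∑ K, m K * p J K) + w * m J) ^ 2
        - lam * (m J * ∑ K, m K * W J K))
      = -lam ^ 2 * (∑ J, m J * (∑ K, m K * p J K) ^ 2) - 2 * lam * w * ∑ J, ∑ K, m J * m K * p J K
        - w ^ 2 * (∑ J, m J) + lam * ∑ J, ∑ K, m K * W J K := by
    simp only [mul_assoc (m _), ← Finset.mul_sum (Finset.univ) _ (m _)]
    rw [Finset.mul_sum, Finset.mul_sum, Finset.mul_sum, Finset.mul_sum, ← Finset.sum_sub_distrib,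
      ← Finset.sum_sub_distrib, ← Finset.sum_add_distrib]
    refine Finset.sum_congr rfl fun J _ => ?_
    have := hm J
    field_simp
    ring
  have hanti : ∑ J, ∑ K, m J * m K * p J K = 0 :=
    sum_antisymm_eq_zero fun J K => by rw [hp J K]; ring
  have hsymm : ∑ J, ∑ K, m K * W J K = ∑ J, ∑ K, m J * W J K := by
    rw [Finset.sum_comm]
    simp only [hW]
  have hsymm2 : ∑ J, ∑ K, m J * m K ^ 2 * W J K = ∑ J, ∑ K, m J ^ 2 * m K * W J K := by
    rw [Finset.sum_comm]
    refine Finset.sum_congr rfl fun J _ => Finset.sum_congr rfl fun K _ => ?_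
    rw [hW K J]
    ring
  have hpot : ∑ J, ∑ K, (-lam * (m J + m K) * (1 - lam * (m J * m K))) * W J K
      = -lam * ∑ J, ∑ K, m J * W J K - lam * ∑ J, ∑ K, m K * W J K
        + lam ^ 2 * ∑ J, ∑ K, m J ^ 2 * m K * W J K
        + lam ^ 2 * ∑ J, ∑ K, m J * m K ^ 2 * W J K := by
    simp only [Finset.mul_sum, ← Finset.sum_sub_distrib, ← Finset.sum_add_distrib]
    exact Finset.sum_congr rfl fun J _ => Finset.sum_congr rfl fun K _ => by ring
  have hΛs : ∀ J K, J ≠ K → Λ J K = Λ K J := fun J K h => by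
    have h1 := hΛ J K h
    have h2 := hΛ K J h.symm
    rw [hW K J, hp K J] at h2
    linear_combination (h1 - h2) / 2
  -- Only `e J K + e K J` is prescribed, so the sum is symmetrized using that `Λ` is symmetric off
  -- the diagonal. The subtracted `∑ m J ^ 2` accounts for the missing diagonal constants.
  have hbeta : 4 * ∑ J, ∑ K, e J K * Λ J K
      = -lam * ∑ J, ∑ K, m J * m K * (W J K - p J K ^ 2)
        + lam * (c + 2 * d) * ((∑ J, m J) ^ 2 - ∑ J, m J ^ 2) := by
    have h1 : ∑ J, ∑ K, e J K * Λ J K = ∑ J, ∑ K, e K J * Λ K J := Finset.sum_comm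
    have h2 : 4 * ∑ J, ∑ K, e J K * Λ J K
        = ∑ J, ∑ K, (2 * (e J K * Λ J K) + 2 * (e K J * Λ K J)) := by
      simp only [Finset.sum_add_distrib, ← Finset.mul_sum]
      rw [← h1]
      ring
    have h4 : ∑ J, m J ^ 2 = ∑ J, ∑ K, (if J = K then m J * m K else 0) := by
      refine Finset.sum_congr rfl fun J _ => ?_
      simp only [Finset.sum_ite_eq, Finset.mem_univ, if_true]
      ring
    rw [h2, sq (∑ J, m J), Finset.sum_mul_sum, h4]
    simp only [Finset.mul_sum, ← Finset.sum_sub_distrib, ← Finset.sum_add_distrib]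
    refine Finset.sum_congr rfl fun J _ => Finset.sum_congr rfl fun K _ => ?_
    by_cases h : J = K
    · subst h
      simp [he0, hp0, hW0]
    · simp only [h, if_false]
      rw [← hΛs J K h]
      linear_combination (2 * Λ J K) * he J K h + lam * m J * m K * hΛ J K h
  rw [hkin, hanti, hT, hpot, hsymm2, hsymm]
  linear_combination (lam * (∑ J, m J) / 2) * hbeta

end Algebra

/-! ### Local powers of θ and derivatives of the source function -/

/-- Near `r`, the function `k b r` behaves like the power `θ(r)^e`, for `b` near `β`. -/
def IsLocalPower (β : ℝ) (e : ℂ) (k : ℝ → ℂ → ℂ) (r : ℂ) : Prop :=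
  AnalyticAt ℂ (k β) r ∧ ∃ kd : ℂ → ℂ, ContinuousAt kd r ∧
    (∀ᶠ s in 𝓝 r, HasDerivAt (fun b => k b s) (kd s) β) ∧
    ∀ᶠ s in 𝓝 r, theta β s ≠ 0 →
      HasDerivAt (k β) (e * phi β s * k β s) s ∧ kd s = e * dlogTheta β s * k β s

/-- Logarithmic derivatives add; nothing is divided by, so the factors may vanish. -/
theorem hasDerivAt_prod_of_log {κ 𝕜 : Type*} [NontriviallyNormedField 𝕜] [NormedAlgebra 𝕜 ℂ]
    (s : Finset κ) {f : κ → 𝕜 → ℂ} {a : κ → ℂ} {t : 𝕜}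
    (h : ∀ i ∈ s, HasDerivAt (f i) (a i * f i t) t) :
    HasDerivAt (fun t => ∏ i ∈ s, f i t) ((∑ i ∈ s, a i) * ∏ i ∈ s, f i t) t := by
  classical
  induction s using Finset.induction_on with
  | empty => simpa using hasDerivAt_const t (1 : ℂ)
  | insert i s hi ih =>
    simp only [Finset.prod_insert hi, Finset.sum_insert hi]
    have h1 := h i (Finset.mem_insert_self i s)
    have h2 := ih fun j hj => h j (Finset.mem_insert_of_mem hj)
    refine (h1.mul h2).congr_deriv ?_
    ring

section Source

variable {ι : Type*}

/-- The source function: a product of pair factors and a plane wave. -/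
def sourceFun [Fintype ι] (k : ι → ι → ℝ → ℂ → ℂ) (m : ι → ℂ) (w c : ℂ) (b : ℝ) (X : ι → ℂ) : ℂ :=
  c * (∏ P : ι × ι, k P.1 P.2 b (X P.1 - X P.2)) * exp (w * ∑ J, m J * X J)

/-- The second partial derivative in the direction of the coordinate `J`. -/
def secondPartial [DecidableEq ι] (f : (ι → ℂ) → ℂ) (J : ι) (X : ι → ℂ) : ℂ :=
  iteratedDeriv 2 (fun t : ℂ => f (Function.update X J t)) (X J)

theorem secondPartial_eq [DecidableEq ι] (f : (ι → ℂ) → ℂ) (J : ι) (X : ι → ℂ) :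
    secondPartial f J X = deriv (deriv fun t : ℂ => f (Function.update X J t)) (X J) := by
  rw [secondPartial, iteratedDeriv_succ, iteratedDeriv_one]

/-- For analytic `f` the second slice derivative is an iterated directional Fréchet derivative,
which is continuous. This is needed to pass to the limit at collision points. -/
theorem continuousAt_secondPartial [Fintype ι] [DecidableEq ι] {f : (ι → ℂ) → ℂ} {X : ι → ℂ}
    (hf : AnalyticAt ℂ f X) (J : ι) : ContinuousAt (secondPartial f J) X := by
  set v : ι → ℂ := Pi.single J 1
  set g : (ι → ℂ) → ℂ := fun Y => fderiv ℂ f Y v with hg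
  have hga : ∀ {Y}, AnalyticAt ℂ f Y → AnalyticAt ℂ g Y := fun h =>
    (ContinuousLinearMap.apply ℂ ℂ v).analyticAt _ |>.comp h.fderiv
  have hslice : ∀ (Y : ι → ℂ) (t : ℂ), HasDerivAt (fun t : ℂ => Function.update Y J t) v t :=
    fun Y t => hasDerivAt_update Y J t
  have hd : ∀ {h : (ι → ℂ) → ℂ} {Y : ι → ℂ} {t : ℂ}, AnalyticAt ℂ h (Function.update Y J t) →
      deriv (fun t : ℂ => h (Function.update Y J t)) t = fderiv ℂ h (Function.update Y J t) v :=
    fun {h Y t} hh => (hh.differentiableAt.hasFDerivAt.comp_hasDerivAt t (hslice Y t)).deriv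
  have hc : ContinuousAt (fun Y => fderiv ℂ g Y v) X :=
    ((hga hf).fderiv.continuousAt.clm_apply continuousAt_const)
  refine hc.congr ?_
  filter_upwards [hf.eventually_analyticAt.eventually_nhds] with Y hY
  have hcont : Tendsto (fun t : ℂ => Function.update Y J t) (𝓝 (Y J)) (𝓝 Y) := by
    have := (hslice Y (Y J)).continuousAt.tendsto
    rwa [Function.update_eq_self] at this
  have hev : (deriv fun t : ℂ => f (Function.update Y J t))
      =ᶠ[𝓝 (Y J)] fun t => g (Function.update Y J t) := by
    filter_upwards [hcont.eventually hY] with t ht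
    exact hd ht
  have hgY : AnalyticAt ℂ g (Function.update Y J (Y J)) := by
    rw [Function.update_eq_self]
    exact hga hY.self_of_nhds
  rw [secondPartial_eq, hev.deriv_eq, hd hgY, Function.update_eq_self]

section Kernel

variable {k : ι → ι → ℝ → ℂ → ℂ} {m : ι → ℂ} {w c : ℂ} {β : ℝ} {e : ι → ι → ℂ}

theorem analyticAt_sourceFun [Fintype ι] {X : ι → ℂ} (hk : ∀ J K, AnalyticAt ℂ (k J K β) (X J - X K)) :
    AnalyticAt ℂ (sourceFun k m w c β) X := by
  have hproj : ∀ J, AnalyticAt ℂ (fun X : ι → ℂ => X J) X := fun J =>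
    (ContinuousLinearMap.proj (R := ℂ) (φ := fun _ : ι => ℂ) J).analyticAt X
  have h1 : AnalyticAt ℂ (fun X : ι → ℂ => ∏ P : ι × ι, k P.1 P.2 β (X P.1 - X P.2)) X :=
    Finset.analyticAt_fun_prod _ fun P _ =>
      AnalyticAt.fun_comp (hk P.1 P.2) ((hproj P.1).sub (hproj P.2))
  have h2 : AnalyticAt ℂ (fun X : ι → ℂ => w * ∑ J, m J * X J) X :=
    analyticAt_const.mul (Finset.analyticAt_fun_sum _ fun J _ => analyticAt_const.mul (hproj J))
  exact (analyticAt_const.mul h1).mul h2.cexp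

/-- The points at which no two particles are equal modulo periods and all pair factors are
powers of `θ`. -/
def IsRegular (k : ι → ι → ℝ → ℂ → ℂ) (e : ι → ι → ℂ) (β : ℝ) (Y : ι → ℂ) : Prop :=
  ∀ A B, A ≠ B → theta β (Y A - Y B) ≠ 0 ∧
    HasDerivAt (k A B β) (e A B * phi β (Y A - Y B) * k A B β (Y A - Y B)) (Y A - Y B)

/-- The values of a function of the difference of two distinct particles. -/
def pairValue [DecidableEq ι] (f : ℂ → ℂ) (X : ι → ℂ) (J K : ι) : ℂ :=
  if J = K then 0 else f (X J - X K)

/-- Particle `J` occurs in both slots of the ordered pairs. As `phi` is odd, the two contributions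
merge into the exponent `e J K + e K J`. -/
theorem hasDerivAt_sourceFun_slice [Fintype ι] [DecidableEq ι] (hk1 : ∀ A b r, k A A b r = 1)
    (he0 : ∀ A, e A A = 0) {Y : ι → ℂ} (hY : IsRegular k e β Y) (J : ι) :
    HasDerivAt (fun t : ℂ => sourceFun k m w c β (Function.update Y J t))
      ((∑ K, (e J K + e K J) * pairValue (phi β) Y J K + w * m J) * sourceFun k m w c β Y)
      (Y J) := by
  have hcoord : ∀ A, HasDerivAt (fun t : ℂ => Function.update Y J t A)
      (if A = J then 1 else 0) (Y J) := by
    intro A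
    by_cases h : A = J
    · subst h
      simpa using hasDerivAt_id' (Y A)
    · simpa [h] using hasDerivAt_const (Y J) (Y A)
  have hfac : ∀ P ∈ (Finset.univ : Finset (ι × ι)), HasDerivAt
      (fun t : ℂ => k P.1 P.2 β (Function.update Y J t P.1 - Function.update Y J t P.2))
      ((e P.1 P.2 * phi β (Y P.1 - Y P.2)
        * ((if P.1 = J then 1 else 0) - (if P.2 = J then 1 else 0)))
        * k P.1 P.2 β (Function.update Y J (Y J) P.1 - Function.update Y J (Y J) P.2)) (Y J) := by
    rintro ⟨A, B⟩ -
    by_cases hAB : A = B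
    · subst hAB
      simp only [hk1, he0]
      simpa using hasDerivAt_const (Y J) (1 : ℂ)
    · have h1 := (hcoord A).sub (hcoord B)
      have h2 := (hY A B hAB).2
      have h3 : HasDerivAt (k A B β) (e A B * phi β (Y A - Y B) * k A B β (Y A - Y B))
          (Function.update Y J (Y J) A - Function.update Y J (Y J) B) := by
        rwa [Function.update_eq_self]
      refine (HasDerivAt.comp (Y J) h3 h1).congr_deriv ?_
      rw [Function.update_eq_self]
      ring
  have hprod := hasDerivAt_prod_of_log _ hfac
  have hexp : HasDerivAt (fun t : ℂ => w * ∑ A, m A * Function.update Y J t A) (w * m J) (Y J) := by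
    have := (HasDerivAt.fun_sum (u := Finset.univ) fun A _ => (hcoord A).const_mul (m A)).const_mul w
    refine this.congr_deriv ?_
    simp
  have htot := (hprod.const_mul c).mul hexp.cexp
  refine htot.congr_deriv ?_
  rw [Function.update_eq_self]
  have hsum : ∑ P : ι × ι, e P.1 P.2 * phi β (Y P.1 - Y P.2)
        * ((if P.1 = J then 1 else 0) - (if P.2 = J then 1 else 0))
      = ∑ K, (e J K + e K J) * pairValue (phi β) Y J K := by
    rw [Fintype.sum_prod_type]
    simp only [mul_sub, Finset.sum_sub_distrib, mul_ite, mul_one, mul_zero, Finset.sum_ite_eq',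
      Finset.mem_univ, if_true]
    rw [Finset.sum_comm]
    simp only [Finset.sum_ite_eq', Finset.mem_univ, if_true]
    rw [← Finset.sum_sub_distrib]
    refine Finset.sum_congr rfl fun K _ => ?_
    by_cases h : J = K
    · subst h
      simp [he0]
    · rw [pairValue, if_neg h, show Y K - Y J = -(Y J - Y K) by ring, phi_neg]
      ring
  rw [hsum, sourceFun]
  ring

theorem hasDerivAt_pairValue_slice [DecidableEq ι] (hβ : 0 < β) {Y : ι → ℂ}
    (hY : ∀ A B, A ≠ B → theta β (Y A - Y B) ≠ 0) (J K : ι) :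
    HasDerivAt (fun t : ℂ => pairValue (phi β) (Function.update Y J t) J K)
      (-pairValue (V β) Y J K) (Y J) := by
  by_cases h : J = K
  · subst h
    simpa [pairValue] using hasDerivAt_const (Y J) (0 : ℂ)
  · simp only [pairValue, h, if_false, Function.update_self, Function.update_of_ne (Ne.symm h)]
    exact (hasDerivAt_phi hβ (hY J K h)).comp_sub_const (Y J) (Y K)

/-- This is `G''/G = ((log G)')² + (log G)''` with `phi' = -V`, the first-order formula being valid
in a whole neighbourhood. -/
theorem secondPartial_sourceFun [Fintype ι] [DecidableEq ι] (hβ : 0 < β) (hk1 : ∀ A b r, k A A b r = 1)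
    (he0 : ∀ A, e A A = 0) {X : ι → ℂ} (hX : ∀ᶠ Y in 𝓝 X, IsRegular k e β Y) (J : ι) :
    secondPartial (sourceFun k m w c β) J X
      = ((∑ K, (e J K + e K J) * pairValue (phi β) X J K + w * m J) ^ 2
          - ∑ K, (e J K + e K J) * pairValue (V β) X J K) * sourceFun k m w c β X := by
  have hcont : Tendsto (fun t : ℂ => Function.update X J t) (𝓝 (X J)) (𝓝 X) := by
    have := (hasDerivAt_update X J (X J)).continuousAt.tendsto
    rwa [Function.update_eq_self] at this
  have hev : (deriv fun t : ℂ => sourceFun k m w c β (Function.update X J t)) =ᶠ[𝓝 (X J)]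
      fun t => (∑ K, (e J K + e K J) * pairValue (phi β) (Function.update X J t) J K + w * m J)
        * sourceFun k m w c β (Function.update X J t) := by
    filter_upwards [hcont.eventually hX] with t ht
    have h := hasDerivAt_sourceFun_slice (m := m) (w := w) (c := c) hk1 he0 ht J
    simp only [Function.update_idem, Function.update_self] at h
    exact h.deriv
  have hX0 := hX.self_of_nhds
  have h1 := hasDerivAt_sourceFun_slice (m := m) (w := w) (c := c) hk1 he0 hX0 J
  have h2 : HasDerivAt (fun t => ∑ K, (e J K + e K J)
      * pairValue (phi β) (Function.update X J t) J K + w * m J)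
      (∑ K, (e J K + e K J) * -pairValue (V β) X J K) (X J) :=
    (HasDerivAt.fun_sum fun K _ => (hasDerivAt_pairValue_slice hβ
      (fun A B hAB => (hX0 A B hAB).1) J K).const_mul _).add_const _
  have h3 := h2.mul h1
  rw [secondPartial_eq, hev.deriv_eq]
  refine h3.deriv.trans ?_
  rw [Function.update_eq_self]
  simp only [mul_neg, Finset.sum_neg_distrib]
  ring

end Kernel

end Source

/-! ### The source identity -/

theorem tendsto_sub_apply {ι : Type*} (X : ι → ℂ) (A B : ι) :
    Tendsto (fun Y : ι → ℂ => Y A - Y B) (𝓝 X) (𝓝 (X A - X B)) := by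
  have : ContinuousAt (fun Y : ι → ℂ => Y A - Y B) X := by fun_prop
  exact this

section Source

variable {ι : Type*} [Fintype ι] {k : ι → ι → ℝ → ℂ → ℂ} {m : ι → ℂ} {lam w c : ℂ} {β : ℝ}
  {e : ι → ι → ℂ}

/-- The constant of the source identity in terms of the power sums of the charges. -/
def sourceConst (m : ι → ℂ) (lam : ℂ) (β : ℝ) : ℂ :=
  lam ^ 2 * c0 β * ((∑ J, m J) * (∑ J, m J ^ 2) - ∑ J, m J ^ 3)
    + lam ^ 2 * c1 * ((∑ J, m J) ^ 3 - (∑ J, m J) * (∑ J, m J ^ 2))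

/-- The left-hand side of the source identity. -/
def sourceExpr [DecidableEq ι] (k : ι → ι → ℝ → ℂ → ℂ) (m : ι → ℂ) (lam w c : ℂ) (β : ℝ)
    (X : ι → ℂ) : ℂ :=
  ∑ J, (-1 / m J) * secondPartial (sourceFun k m w c β) J X
    + (1 / 2 * ∑ J, ∑ K, (-lam * (m J + m K) * (1 - lam * (m J * m K))) * pairValue (V β) X J K)
      * sourceFun k m w c β X
    + 2 * lam * (∑ J, m J) * deriv (fun b => sourceFun k m w c b X) β
    - (sourceConst m lam β - (∑ J, m J) * w ^ 2) * sourceFun k m w c β X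

theorem sourceExpr_eq_zero_of_isRegular [DecidableEq ι] (hβ : 0 < β) (hm : ∀ J, m J ≠ 0)
    (hk1 : ∀ A b r, k A A b r = 1)
    (he : ∀ J K, J ≠ K → e J K + e K J = lam * (m J * m K)) (he0 : ∀ J, e J J = 0)
    {X : ι → ℂ} (hX : ∀ᶠ Y in 𝓝 X, IsRegular k e β Y)
    (hdot : ∀ A B, A ≠ B → HasDerivAt (fun b => k A B b (X A - X B))
      (e A B * dlogTheta β (X A - X B) * k A B β (X A - X B)) β) :
    sourceExpr k m lam w c β X = 0 := by
  have hth : ∀ A B, A ≠ B → theta β (X A - X B) ≠ 0 := fun A B h => (hX.self_of_nhds A B h).1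
  have hfac : ∀ P ∈ (Finset.univ : Finset (ι × ι)), HasDerivAt
      (fun b => k P.1 P.2 b (X P.1 - X P.2))
      ((e P.1 P.2 * pairValue (dlogTheta β) X P.1 P.2) * k P.1 P.2 β (X P.1 - X P.2)) β := by
    rintro ⟨A, B⟩ -
    by_cases h : A = B
    · subst h
      simp only [hk1, he0]
      simpa using hasDerivAt_const β (1 : ℂ)
    · simp only [pairValue, if_neg h]
      exact hdot A B h
  have hparam : deriv (fun b => sourceFun k m w c b X) β
      = (∑ J, ∑ K, e J K * pairValue (dlogTheta β) X J K) * sourceFun k m w c β X := by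
    have h := ((hasDerivAt_prod_of_log _ hfac).const_mul c).mul_const (exp (w * ∑ J, m J * X J))
    refine h.deriv.trans ?_
    rw [sourceFun, Fintype.sum_prod_type]
    ring
  have hpair : ∀ (f : ℂ → ℂ) J, ∑ K, (e J K + e K J) * pairValue f X J K
      = lam * (m J * ∑ K, m K * pairValue f X J K) := by
    intro f J
    rw [Finset.mul_sum, Finset.mul_sum]
    refine Finset.sum_congr rfl fun K _ => ?_
    by_cases h : J = K
    · simp [pairValue, h]
    · rw [he J K h]
      ring
  have hsub : ∀ J K, X K - X J = -(X J - X K) := fun J K => by ring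
  have halg := source_identity_algebra (m := m) hm (p := pairValue (phi β) X)
    (W := pairValue (V β) X) (Λ := pairValue (dlogTheta β) X) (e := e) (c := c0 β) (d := c1)
    (lam := lam) (w := w)
    (fun J K => by
      by_cases h : J = K
      · simp [pairValue, h]
      · rw [pairValue, pairValue, if_neg h, if_neg (Ne.symm h), hsub J K, phi_neg, neg_neg])
    (fun J K => by
      by_cases h : J = K
      · simp [h]
      · rw [pairValue, pairValue, if_neg h, if_neg (Ne.symm h), hsub J K, V_neg])
    (fun J => by simp [pairValue])
    (fun J K L hJK hKL hLJ => by
      simp only [pairValue, if_neg hJK, if_neg hKL, if_neg hLJ]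
      exact phi_add_add_sq hβ (by ring) (hth _ _ hJK) (hth _ _ hKL) (hth _ _ hLJ))
    (fun J K hJK => by
      simp only [pairValue, if_neg hJK]
      exact two_mul_dlogTheta hβ (hth _ _ hJK))
    he he0
  have hsecond : ∀ J, (-1 / m J) * secondPartial (sourceFun k m w c β) J X
      = ((-1 / m J) * ((lam * (m J * ∑ K, m K * pairValue (phi β) X J K) + w * m J) ^ 2
        - lam * (m J * ∑ K, m K * pairValue (V β) X J K))) * sourceFun k m w c β X := by
    intro J
    rw [secondPartial_sourceFun hβ hk1 he0 hX, hpair, hpair]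
    ring
  rw [sourceExpr, hparam, Finset.sum_congr rfl fun J _ => hsecond J, ← Finset.sum_mul, sourceConst]
  linear_combination sourceFun k m w c β X * halg

/-- A direction with distinct coordinates makes every difference a nonconstant affine function of
`t`, and the zeros of `θ` are isolated. -/
theorem exists_line_theta_ne_zero (hβ : 0 < β) (X : ι → ℂ) :
    ∃ ξ : ι → ℂ, ∀ᶠ t : ℂ in 𝓝[≠] 0, ∀ A B, A ≠ B →
      theta β ((X + t • ξ) A - (X + t • ξ) B) ≠ 0 := by
  refine ⟨fun J => (Fintype.equivFin ι J : ℕ), ?_⟩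
  rw [eventually_all]
  intro A
  rw [eventually_all]
  intro B
  by_cases hAB : A = B
  · simp [hAB]
  have hne : ((Fintype.equivFin ι A : ℕ) : ℂ) - ((Fintype.equivFin ι B : ℕ) : ℂ) ≠ 0 := by
    rw [sub_ne_zero, Ne, Nat.cast_inj, Fin.val_inj, EmbeddingLike.apply_eq_iff_eq]
    exact hAB
  set d : ℂ := ((Fintype.equivFin ι A : ℕ) : ℂ) - ((Fintype.equivFin ι B : ℕ) : ℂ)
  have ht : Tendsto (fun t : ℂ => (X A - X B) + t * d) (𝓝[≠] 0) (𝓝[≠] (X A - X B)) := by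
    refine tendsto_nhdsWithin_of_tendsto_nhds_of_eventually_within _ ?_ ?_
    · have : ContinuousAt (fun t : ℂ => (X A - X B) + t * d) 0 := by fun_prop
      have h := this.tendsto.mono_left (nhdsWithin_le_nhds (s := {0}ᶜ))
      simpa using h
    · filter_upwards [self_mem_nhdsWithin] with t ht h0
      have h1 : (X A - X B) + t * d = X A - X B := h0
      rw [add_eq_left] at h1
      exact (mul_ne_zero ht hne) h1
  filter_upwards [ht.eventually (eventually_theta_ne_zero hβ _)] with t h _
  convert! h using 2
  simp only [Pi.add_apply, Pi.smul_apply, smul_eq_mul, d]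
  ring

variable {X : ι → ℂ}

/-- The product rule is used instead of logarithmic derivatives because factors may vanish at `X`.
Continuity of `Gd` lets the `β`-derivative pass to the limit. -/
theorem differentiableAt_sourceFun_param
    (hk : ∀ J K, IsLocalPower β (e J K) (k J K) (X J - X K)) :
    ∃ Gd : (ι → ℂ) → ℂ, ContinuousAt Gd X ∧
      ∀ᶠ Y in 𝓝 X, HasDerivAt (fun b => sourceFun k m w c b Y) (Gd Y) β := by
  classical
  choose ha kd hkc hkd _ using hk
  refine ⟨fun Y => c * (∑ P : ι × ι, (∏ Q ∈ Finset.univ.erase P, k Q.1 Q.2 β (Y Q.1 - Y Q.2))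
    • kd P.1 P.2 (Y P.1 - Y P.2)) * exp (w * ∑ J, m J * Y J), ?_, ?_⟩
  · have h1 : ∀ Q : ι × ι, ContinuousAt (fun Y : ι → ℂ => k Q.1 Q.2 β (Y Q.1 - Y Q.2)) X :=
      fun Q => (ha Q.1 Q.2).continuousAt.tendsto.comp (tendsto_sub_apply X Q.1 Q.2)
    have h2 : ∀ Q : ι × ι, ContinuousAt (fun Y : ι → ℂ => kd Q.1 Q.2 (Y Q.1 - Y Q.2)) X :=
      fun Q => (hkc Q.1 Q.2).tendsto.comp (tendsto_sub_apply X Q.1 Q.2)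
    have h3 : ContinuousAt (fun Y : ι → ℂ => exp (w * ∑ J, m J * Y J)) X := by
      have h4 : Continuous fun Y : ι → ℂ => ∑ J, m J * Y J :=
        continuous_finsetSum _ fun J _ => by fun_prop
      exact (continuous_exp.comp (continuous_const.mul h4)).continuousAt
    refine (continuousAt_const.mul (tendsto_finsetSum _ fun P _ => ?_)).mul h3
    exact (tendsto_finsetProd _ fun Q _ => h1 Q).smul (h2 P)
  · have hall : ∀ᶠ Y in 𝓝 X, ∀ P : ι × ι, HasDerivAt (fun b => k P.1 P.2 b (Y P.1 - Y P.2))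
        (kd P.1 P.2 (Y P.1 - Y P.2)) β := by
      rw [eventually_all]
      exact fun P => (tendsto_sub_apply X P.1 P.2).eventually (hkd P.1 P.2)
    filter_upwards [hall] with Y hY
    exact ((HasDerivAt.fun_finsetProd fun P _ => hY P).const_mul c).mul_const _

/-- The source identity, including at points where some factors with a vanishing coupling are
zero. -/
theorem sourceExpr_eq_zero [DecidableEq ι] (hβ : 0 < β) (hm : ∀ J, m J ≠ 0)
    (hk1 : ∀ A b r, k A A b r = 1)
    (he : ∀ J K, J ≠ K → e J K + e K J = lam * (m J * m K)) (he0 : ∀ J, e J J = 0)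
    (hk : ∀ J K, IsLocalPower β (e J K) (k J K) (X J - X K))
    (hV : ∀ J K, J ≠ K → -lam * (m J + m K) * (1 - lam * (m J * m K)) = 0 ∨
      theta β (X J - X K) ≠ 0) :
    sourceExpr k m lam w c β X = 0 := by
  obtain ⟨Gd, hGd, hGder⟩ := differentiableAt_sourceFun_param (m := m) (w := w) (c := c) hk
  have hcG : ContinuousAt (sourceFun k m w c β) X :=
    (analyticAt_sourceFun fun J K => (hk J K).1).continuousAt
  have hcE : ContinuousAt (sourceExpr k m lam w c β) X := by
    have h1 : ContinuousAt (fun Y => ∑ J, (-1 / m J) * secondPartial (sourceFun k m w c β) J Y) X :=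
      tendsto_finsetSum _ fun J _ => continuousAt_const.mul
        (continuousAt_secondPartial (analyticAt_sourceFun fun J K => (hk J K).1) J)
    -- Wherever `V` might be singular its coupling is zero, so the potential stays continuous.
    have h2 : ContinuousAt (fun Y => ∑ J, ∑ K, (-lam * (m J + m K) * (1 - lam * (m J * m K)))
        * pairValue (V β) Y J K) X := by
      refine tendsto_finsetSum _ fun J _ => tendsto_finsetSum _ fun K _ => ?_
      by_cases h : J = K
      · simp [pairValue, h]
      · rcases hV J K h with h0 | h0
        · simp only [h0, zero_mul]
          exact tendsto_const_nhds
        · simp only [pairValue, if_neg h]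
          exact ((differentiableAt_V hβ h0).continuousAt.tendsto.comp
            (tendsto_sub_apply X J K)).const_mul _
    have h3 : ContinuousAt (fun Y => deriv (fun b => sourceFun k m w c b Y) β) X :=
      hGd.congr (hGder.mono fun Y hY => hY.deriv.symm)
    exact ((h1.add ((continuousAt_const.mul h2).mul hcG)).add (continuousAt_const.mul h3)).sub
      (continuousAt_const.mul hcG)
  have hnear : ∀ᶠ Y in 𝓝 X, ∀ A B, theta β (Y A - Y B) ≠ 0 →
      HasDerivAt (k A B β) (e A B * phi β (Y A - Y B) * k A B β (Y A - Y B)) (Y A - Y B) ∧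
      HasDerivAt (fun b => k A B b (Y A - Y B))
        (e A B * dlogTheta β (Y A - Y B) * k A B β (Y A - Y B)) β := by
    rw [eventually_all]
    intro A
    rw [eventually_all]
    intro B
    obtain ⟨_, kd, _, h1, h2⟩ := hk A B
    filter_upwards [(tendsto_sub_apply X A B).eventually (h1.and h2)] with Y hY h0
    refine ⟨(hY.2 h0).1, ?_⟩
    rw [← (hY.2 h0).2]
    exact hY.1
  obtain ⟨ξ, hξ⟩ := exists_line_theta_ne_zero hβ X
  have hline : ContinuousAt (fun t : ℂ => X + t • ξ) 0 := by fun_prop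
  have hline0 : X + (0 : ℂ) • ξ = X := by simp
  have hlim : Tendsto (fun t : ℂ => X + t • ξ) (𝓝[≠] 0) (𝓝 X) := by
    have h := hline.tendsto.mono_left (nhdsWithin_le_nhds (s := {0}ᶜ))
    rwa [hline0] at h
  have hzero : ∀ᶠ t : ℂ in 𝓝[≠] 0, sourceExpr k m lam w c β (X + t • ξ) = 0 := by
    filter_upwards [hξ, hlim.eventually hnear.eventually_nhds] with t ht1 ht2
    have hth : ∀ᶠ Y in 𝓝 (X + t • ξ), ∀ A B, A ≠ B → theta β (Y A - Y B) ≠ 0 := by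
      rw [eventually_all]
      intro A
      rw [eventually_all]
      intro B
      by_cases hAB : A = B
      · simp [hAB]
      · filter_upwards [(tendsto_sub_apply (X + t • ξ) A B).eventually
          ((differentiable_theta hβ).continuous.continuousAt.eventually_ne (ht1 A B hAB))]
          with Y hY _ using hY
    refine sourceExpr_eq_zero_of_isRegular hβ hm hk1 he he0 ?_ fun A B hAB =>
      (ht2.self_of_nhds A B (ht1 A B hAB)).2
    filter_upwards [hth, ht2] with Y hY1 hY2 A B hAB
    exact ⟨hY1 A B hAB, (hY2 A B (hY1 A B hAB)).1⟩
  -- The expression is continuous at `X` and zero along the punctured line, hence zero at `X`.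
  have h1 := hcE.tendsto.comp hlim
  exact tendsto_nhds_unique (h1.congr' hzero) tendsto_const_nhds |>.trans rfl

end Source

/-! ### Branches of log θ -/

/-- Continuity keeps the imaginary part of `f t - f t₀` within `(-π, π)`, where the principal
logarithm inverts `exp`. A merely continuous branch thus inherits differentiability. -/
theorem eventually_eq_add_log {T : Type*} [TopologicalSpace T] {f g : T → ℂ} {t₀ : T}
    (hf : ContinuousAt f t₀) (hg : ∀ᶠ t in 𝓝 t₀, exp (f t) = g t) :
    ∀ᶠ t in 𝓝 t₀, f t = f t₀ + log (g t / g t₀) := by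
  have h0 : exp (f t₀) = g t₀ := hg.self_of_nhds
  have hc : Tendsto (fun t => (f t - f t₀).im) (𝓝 t₀) (𝓝 0) := by
    have : ContinuousAt (fun t => (f t - f t₀).im) t₀ :=
      continuous_im.continuousAt.comp (hf.sub continuousAt_const)
    simpa [ContinuousAt] using this
  filter_upwards [hg, hc.eventually_lt_const Real.pi_pos,
    hc.eventually_const_lt (neg_lt_zero.2 Real.pi_pos)] with t ht h1 h2
  rw [← ht, ← h0, ← exp_sub, log_exp h2 h1.le]
  ring

theorem hasDerivAt_of_exp_eq {f g : ℂ → ℂ} {g' t₀ : ℂ} (hf : ContinuousAt f t₀)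
    (hg : ∀ᶠ t in 𝓝 t₀, exp (f t) = g t) (hd : HasDerivAt g g' t₀) :
    HasDerivAt f (g' / g t₀) t₀ := by
  have h0 : g t₀ ≠ 0 := hg.self_of_nhds ▸ exp_ne_zero _
  have h1 := ((hd.div_const (g t₀)).clog (by simp [div_self h0])).const_add (f t₀)
  rw [div_self h0, div_one] at h1
  exact h1.congr_of_eventuallyEq (eventually_eq_add_log hf hg)

theorem hasDerivAt_of_exp_eq_real {f g : ℝ → ℂ} {g' : ℂ} {t₀ : ℝ} (hf : ContinuousAt f t₀)
    (hg : ∀ᶠ t in 𝓝 t₀, exp (f t) = g t) (hd : HasDerivAt g g' t₀) :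
    HasDerivAt f (g' / g t₀) t₀ := by
  have h0 : g t₀ ≠ 0 := hg.self_of_nhds ▸ exp_ne_zero _
  have h1 := ((hd.div_const (g t₀)).clog_real (by simp [div_self h0])).const_add (f t₀)
  rw [div_self h0, div_one] at h1
  exact h1.congr_of_eventuallyEq (eventually_eq_add_log hf hg)

theorem isLocalPower_one (β : ℝ) (r : ℂ) : IsLocalPower β 0 (fun _ _ => 1) r := by
  refine ⟨analyticAt_const, fun _ => 0, continuousAt_const, Eventually.of_forall fun s => ?_,
    Eventually.of_forall fun s _ => ⟨?_, by simp⟩⟩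
  · exact hasDerivAt_const β (1 : ℂ)
  · simpa using hasDerivAt_const s (1 : ℂ)

/-- Valid even at zeros of `θ`: there only analyticity in the position and a `β`-derivative
continuous in it are demanded. -/
theorem isLocalPower_theta {β : ℝ} (hβ : 0 < β) (r : ℂ) : IsLocalPower β 1 theta r := by
  refine ⟨(differentiable_theta hβ).analyticAt r, thetaDot β, (continuous_thetaDot hβ).continuousAt,
    Eventually.of_forall (hasDerivAt_theta_param_dot hβ), Eventually.of_forall fun s hs => ⟨?_, ?_⟩⟩
  · rw [one_mul]
    exact hasDerivAt_theta hβ hs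
  · rw [one_mul]
    exact thetaDot_eq hβ hs

theorem isLocalPower_theta_inv {β : ℝ} (hβ : 0 < β) {r : ℂ} (hr : theta β r ≠ 0) :
    IsLocalPower β (-1) (fun b s => (theta b s)⁻¹) r := by
  have hc := (differentiable_theta hβ).continuous
  have hne : ∀ᶠ s in 𝓝 r, theta β s ≠ 0 := hc.continuousAt.eventually_ne hr
  refine ⟨((differentiable_theta hβ).analyticAt r).fun_inv hr,
    fun s => -thetaDot β s / theta β s ^ 2, ?_, ?_, Eventually.of_forall fun s hs => ⟨?_, ?_⟩⟩
  · exact (continuous_thetaDot hβ).continuousAt.neg.div (hc.continuousAt.pow 2) (pow_ne_zero 2 hr)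
  · filter_upwards [hne] with s hs
    exact (hasDerivAt_theta_param_dot hβ s).fun_inv hs
  · refine ((hasDerivAt_theta hβ hs).fun_inv hs).congr_deriv ?_
    field_simp
  · beta_reduce
    rw [thetaDot_eq hβ hs]
    field_simp

theorem theta_ne_zero_of_mem {D : Set (ℂ × ℝ)} {L : ℂ × ℝ → ℂ} (hL : IsLogThetaBranch D L)
    {r : ℂ} {β : ℝ} (h : (r, β) ∈ D) : theta β r ≠ 0 := by
  rw [← hL.2.2.2 _ h]
  exact exp_ne_zero _

theorem isLocalPower_thetaPow {D : Set (ℂ × ℝ)} {L : ℂ × ℝ → ℂ} (hL : IsLogThetaBranch D L)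
    (s : ℂ) {β : ℝ} (hβ : 0 < β) {r : ℂ} (hr : (r, β) ∈ D) :
    IsLocalPower β s (thetaPow L s) r := by
  obtain ⟨hD, _, hLc, hLe⟩ := hL
  have hc := (differentiable_theta hβ).continuous
  have hmem : ∀ᶠ z in 𝓝 r, (z, β) ∈ D := by
    have : ContinuousAt (fun z : ℂ => (z, β)) r := by fun_prop
    exact this.eventually (hD.mem_nhds hr)
  have hmemb : ∀ {z : ℂ}, (z, β) ∈ D → ∀ᶠ b in 𝓝 β, (z, b) ∈ D := by
    intro z hz
    have : ContinuousAt (fun b : ℝ => (z, b)) β := by fun_prop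
    exact this.eventually (hD.mem_nhds hz)
  have hne : ∀ {z : ℂ}, (z, β) ∈ D → theta β z ≠ 0 := fun {z} hz => by
    rw [← hLe _ hz]
    exact exp_ne_zero _
  have hLat : ∀ {z : ℂ}, (z, β) ∈ D → ContinuousAt L (z, β) := fun hz =>
    hLc.continuousAt (hD.mem_nhds hz)
  have hpow : ∀ {z : ℂ}, (z, β) ∈ D →
      HasDerivAt (thetaPow L s β) (s * phi β z * thetaPow L s β z) z := by
    intro z hz
    have hcz : ContinuousAt (fun z => L (z, β)) z :=
      ContinuousAt.comp (g := L) (f := fun z : ℂ => (z, β)) (hLat hz) (by fun_prop)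
    have hev : ∀ᶠ y in 𝓝 z, exp (L (y, β)) = theta β y := by
      have : ContinuousAt (fun z : ℂ => (z, β)) z := by fun_prop
      filter_upwards [this.eventually (hD.mem_nhds hz)] with y hy using hLe _ hy
    have h := hasDerivAt_of_exp_eq hcz hev (hasDerivAt_theta hβ (hne hz))
    rw [mul_div_cancel_right₀ _ (hne hz)] at h
    refine (h.const_mul s).cexp.congr_deriv ?_
    rw [thetaPow]
    ring
  -- The quotient `thetaDot / theta` is used because continuity of `thetaDot` in the position is
  -- already known.
  have hparam : ∀ {z : ℂ}, (z, β) ∈ D → HasDerivAt (fun b => thetaPow L s b z)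
      (s * (thetaDot β z / theta β z) * thetaPow L s β z) β := by
    intro z hz
    have hcb : ContinuousAt (fun b => L (z, b)) β :=
      ContinuousAt.comp (g := L) (f := fun b : ℝ => (z, b)) (hLat hz) (by fun_prop)
    have hev : ∀ᶠ b in 𝓝 β, exp (L (z, b)) = theta b z := by
      filter_upwards [hmemb hz] with b hb using hLe _ hb
    have h := hasDerivAt_of_exp_eq_real hcb hev (hasDerivAt_theta_param_dot hβ z)
    refine (h.const_mul s).cexp.congr_deriv ?_
    rw [thetaPow]
    ring
  have hana : AnalyticAt ℂ (thetaPow L s β) r :=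
    analyticAt_iff_eventually_differentiableAt.2
      (hmem.mono fun z hz => (hpow hz).differentiableAt)
  refine ⟨hana, fun z => s * (thetaDot β z / theta β z) * thetaPow L s β z, ?_,
    hmem.mono fun z hz => hparam hz, hmem.mono fun z hz h0 => ⟨hpow hz, ?_⟩⟩
  · exact (continuousAt_const.mul ((continuous_thetaDot hβ).continuousAt.div hc.continuousAt
      (hne hr))).mul hana.continuousAt
  · beta_reduce
    rw [thetaDot_eq hβ h0, mul_div_cancel_right₀ _ h0]

/-! ### The four species of particles -/

/-- The labels of the particles at `x`, `x̃`, `y`, `ỹ`, in this order. -/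
abbrev Particle (N N' M M' : ℕ) : Type := Fin N ⊕ Fin N' ⊕ Fin M ⊕ Fin M'

/-- All positions as one configuration. -/
def config {N N' M M' : ℕ} (x : Fin N → ℂ) (x' : Fin N' → ℂ) (y : Fin M → ℂ) (y' : Fin M' → ℂ) :
    Particle N N' M M' → ℂ :=
  Sum.elim x (Sum.elim x' (Sum.elim y y'))

section

variable {N N' M M' : ℕ}

/-- The charges of the four species of particles. -/
def charge (lam : ℂ) : Particle N N' M M' → ℂ
  | .inl _ => 1
  | .inr (.inl _) => -1 / lam
  | .inr (.inr (.inl _)) => -1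
  | .inr (.inr (.inr _)) => 1 / lam

/-- The exponent of `θ` for an ordered pair of particles in `F`. -/
def pairExponent (lam : ℂ) : Particle N N' M M' → Particle N N' M M' → ℂ
  | .inl j, .inl k => if j < k then lam else 0
  | .inl _, .inr (.inl _) => -1
  | .inl _, .inr (.inr (.inl _)) => -lam
  | .inl _, .inr (.inr (.inr _)) => 1
  | .inr (.inl J), .inr (.inl K) => if J < K then 1 / lam else 0
  | .inr (.inl _), .inr (.inr (.inl _)) => 1
  | .inr (.inl _), .inr (.inr (.inr _)) => -(1 / lam)
  | .inr (.inr (.inl j)), .inr (.inr (.inl k)) => if j < k then lam else 0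
  | .inr (.inr (.inl _)), .inr (.inr (.inr _)) => -1
  | .inr (.inr (.inr J)), .inr (.inr (.inr K)) => if J < K then 1 / lam else 0
  | .inr (.inl _), .inl _ => 0
  | .inr (.inr (.inl _)), .inl _ => 0
  | .inr (.inr (.inl _)), .inr (.inl _) => 0
  | .inr (.inr (.inr _)), .inl _ => 0
  | .inr (.inr (.inr _)), .inr (.inl _) => 0
  | .inr (.inr (.inr _)), .inr (.inr (.inl _)) => 0

/-- The factor of an ordered pair of particles in `F`. -/
def pairKernel (L : ℂ × ℝ → ℂ) (lam : ℂ) :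
    Particle N N' M M' → Particle N N' M M' → ℝ → ℂ → ℂ
  | .inl j, .inl k => if j < k then thetaPow L lam else fun _ _ => 1
  | .inl _, .inr (.inl _) => fun b r => (theta b r)⁻¹
  | .inl _, .inr (.inr (.inl _)) => thetaPow L (-lam)
  | .inl _, .inr (.inr (.inr _)) => theta
  | .inr (.inl J), .inr (.inl K) => if J < K then thetaPow L (1 / lam) else fun _ _ => 1
  | .inr (.inl _), .inr (.inr (.inl _)) => theta
  | .inr (.inl _), .inr (.inr (.inr _)) => thetaPow L (-(1 / lam))
  | .inr (.inr (.inl j)), .inr (.inr (.inl k)) =>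
      if j < k then thetaPow L lam else fun _ _ => 1
  | .inr (.inr (.inl _)), .inr (.inr (.inr _)) => fun b r => (theta b r)⁻¹
  | .inr (.inr (.inr J)), .inr (.inr (.inr K)) =>
      if J < K then thetaPow L (1 / lam) else fun _ _ => 1
  | .inr (.inl _), .inl _ => fun _ _ => 1
  | .inr (.inr (.inl _)), .inl _ => fun _ _ => 1
  | .inr (.inr (.inl _)), .inr (.inl _) => fun _ _ => 1
  | .inr (.inr (.inr _)), .inl _ => fun _ _ => 1
  | .inr (.inr (.inr _)), .inr (.inl _) => fun _ _ => 1
  | .inr (.inr (.inr _)), .inr (.inr (.inl _)) => fun _ _ => 1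

theorem charge_ne_zero {lam : ℂ} (hlam : lam ≠ 0) (J : Particle N N' M M') :
    charge lam J ≠ 0 := by
  rcases J with j | j | j | j <;> simp [charge, hlam]

theorem pairKernel_self (L : ℂ × ℝ → ℂ) (lam : ℂ) (J : Particle N N' M M') (b : ℝ) (r : ℂ) :
    pairKernel L lam J J b r = 1 := by
  rcases J with j | j | j | j <;> simp [pairKernel]

theorem pairExponent_self (lam : ℂ) (J : Particle N N' M M') : pairExponent lam J J = 0 := by
  rcases J with j | j | j | j <;> simp [pairExponent]

theorem ite_lt_add_ite_lt {n : ℕ} {j k : Fin n} (h : j ≠ k) (a : ℂ) :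
    (if j < k then a else 0) + (if k < j then a else 0) = a := by
  rcases lt_or_gt_of_ne h with h | h <;> simp [h, h.not_gt]

/-- Only one ordering of each pair carries a factor, so every exponent in `F` is seen to be `λ`
times a product of charges. -/
theorem pairExponent_add {lam : ℂ} (hlam : lam ≠ 0) (J K : Particle N N' M M') (h : J ≠ K) :
    pairExponent lam J K + pairExponent lam K J = lam * (charge lam J * charge lam K) := by
  rcases J with j | j | j | j <;> rcases K with k | k | k | k <;>
    simp only [pairExponent, charge] <;>
    first
    | rw [ite_lt_add_ite_lt (by simpa using h)]; field_simp
    | field_simp; ring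

theorem isLocalPower_ite {β : ℝ} {n : ℕ} {j k : Fin n} {e : ℂ} {f : ℝ → ℂ → ℂ} {r : ℂ}
    (h : j < k → IsLocalPower β e f r) :
    IsLocalPower β (if j < k then e else 0) (if j < k then f else fun _ _ => 1) r := by
  split_ifs with hjk
  · exact h hjk
  · exact isLocalPower_one β r

theorem isLocalPower_pairKernel {D : Set (ℂ × ℝ)} {L : ℂ × ℝ → ℂ} (hL : IsLogThetaBranch D L)
    (lam : ℂ) {β : ℝ} (hβ : 0 < β) {x : Fin N → ℂ} {x' : Fin N' → ℂ} {y : Fin M → ℂ}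
    {y' : Fin M' → ℂ} (hadm : Admissible D β x x' y y') (J K : Particle N N' M M') :
    IsLocalPower β (pairExponent lam J K) (pairKernel L lam J K)
      (config x x' y y' J - config x x' y y' K) := by
  obtain ⟨h1, h2, h3, h4, h5, h6, h7, h8⟩ := hadm
  have hpow := fun s {r : ℂ} (h : (r, β) ∈ D) => isLocalPower_thetaPow hL s hβ h
  rcases J with j | j | j | j <;> rcases K with k | k | k | k
  · exact isLocalPower_ite fun h => hpow lam (h1 j k h)
  · exact isLocalPower_theta_inv hβ (h7 j k)
  · exact hpow _ (h5 j k)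
  · exact isLocalPower_theta hβ _
  · exact isLocalPower_one β _
  · exact isLocalPower_ite fun h => hpow (1 / lam) (h2 j k h)
  · exact isLocalPower_theta hβ _
  · exact hpow _ (h6 j k)
  · exact isLocalPower_one β _
  · exact isLocalPower_one β _
  · exact isLocalPower_ite fun h => hpow lam (h3 j k h)
  · exact isLocalPower_theta_inv hβ (h8 j k)
  · exact isLocalPower_one β _
  · exact isLocalPower_one β _
  · exact isLocalPower_one β _
  · exact isLocalPower_ite fun h => hpow (1 / lam) (h4 j k h)

/-- The pairs whose `θ` may vanish, `(x, ỹ)` and `(x̃, y)`, have charge product `1/λ`, so the last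
factor of the coupling is zero. -/
theorem coupling_eq_zero_or_theta_ne_zero {D : Set (ℂ × ℝ)} {L : ℂ × ℝ → ℂ}
    (hL : IsLogThetaBranch D L) {lam : ℂ} (hlam : lam ≠ 0) {β : ℝ} {x : Fin N → ℂ}
    {x' : Fin N' → ℂ} {y : Fin M → ℂ} {y' : Fin M' → ℂ} (hadm : Admissible D β x x' y y')
    (J K : Particle N N' M M') (h : J ≠ K) :
    -lam * (charge lam J + charge lam K) * (1 - lam * (charge lam J * charge lam K)) = 0 ∨
      theta β (config x x' y y' J - config x x' y y' K) ≠ 0 := by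
  obtain ⟨h1, h2, h3, h4, h5, h6, h7, h8⟩ := hadm
  have hne := fun {r : ℂ} (h : (r, β) ∈ D) => theta_ne_zero_of_mem hL h
  have hflip : ∀ {a b : ℂ}, theta β (b - a) ≠ 0 → theta β (a - b) ≠ 0 := fun {a b} h => by
    have := theta_neg_ne_zero h
    rwa [neg_sub] at this
  have hsame : ∀ {n : ℕ} {z : Fin n → ℂ}, (∀ j k, j < k → (z j - z k, β) ∈ D) →
      ∀ {j k : Fin n}, j ≠ k → theta β (z j - z k) ≠ 0 := by
    intro n z hz j k hjk
    rcases lt_or_gt_of_ne hjk with h | h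
    · exact hne (hz j k h)
    · exact hflip (hne (hz k j h))
  rcases J with j | j | j | j <;> rcases K with k | k | k | k
  · exact Or.inr (hsame h1 (by simpa using h))
  · exact Or.inr (h7 j k)
  · exact Or.inr (hne (h5 j k))
  · left
    simp only [charge]
    field_simp
    ring
  · exact Or.inr (hflip (h7 k j))
  · exact Or.inr (hsame h2 (by simpa using h))
  · left
    simp only [charge]
    field_simp
    ring
  · exact Or.inr (hne (h6 j k))
  · exact Or.inr (hflip (hne (h5 k j)))
  · left
    simp only [charge]
    field_simp
    ring
  · exact Or.inr (hsame h3 (by simpa using h))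
  · exact Or.inr (h8 j k)
  · left
    simp only [charge]
    field_simp
    ring
  · exact Or.inr (hflip (hne (h6 k j)))
  · exact Or.inr (hflip (h8 k j))
  · exact Or.inr (hsame h4 (by simpa using h))

theorem prod_Ioi_eq {n : ℕ} (f : Fin n → ℂ) (j : Fin n) :
    ∏ k ∈ Finset.Ioi j, f k = ∏ k, if j < k then f k else 1 := by
  rw [← Finset.prod_filter]
  congr 1
  ext k
  simp

theorem thetaPow_neg (L : ℂ × ℝ → ℂ) (s : ℂ) (b : ℝ) (r : ℂ) :
    thetaPow L (-s) b r = (thetaPow L s b r)⁻¹ := by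
  rw [thetaPow, thetaPow, neg_mul, exp_neg]

theorem boostedF_eq_sourceFun (L : ℂ × ℝ → ℂ) (lam c : ℂ) (v b : ℝ) (x : Fin N → ℂ)
    (x' : Fin N' → ℂ) (y : Fin M → ℂ) (y' : Fin M' → ℂ) :
    boostedF L lam c v b x x' y y'
      = sourceFun (pairKernel L lam) (charge lam) (I * v) c b (config x x' y y') := by
  have happ : ∀ {P : Prop} [Decidable P] (f : ℝ → ℂ → ℂ) (r : ℂ),
      (if P then f else fun _ _ => 1) b r = if P then f b r else 1 := by
    intro P _ f r
    split_ifs <;> rfl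
  rw [boostedF, sourceFun, Fintype.prod_prod_type, F, Psi0, Psi0]
  simp only [Fintype.prod_sum_type, Fintype.sum_sum_type, config, Sum.elim_inl, Sum.elim_inr,
    pairKernel, charge, happ, prod_Ioi_eq, Finset.prod_const_one, mul_one, one_mul,
    Finset.prod_mul_distrib, thetaPow_neg, Finset.prod_inv_distrib, ← Finset.mul_sum,
    div_eq_mul_inv, mul_inv]
  congr 1
  · ring
  · congr 2
    ring

theorem update_config_x (x : Fin N → ℂ) (x' : Fin N' → ℂ) (y : Fin M → ℂ) (y' : Fin M' → ℂ)
    (j : Fin N) (t : ℂ) : Function.update (config x x' y y') (.inl j) t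
      = config (Function.update x j t) x' y y' := by
  rw [config, Sum.update_elim_inl, config]

theorem update_config_x' (x : Fin N → ℂ) (x' : Fin N' → ℂ) (y : Fin M → ℂ) (y' : Fin M' → ℂ)
    (j : Fin N') (t : ℂ) : Function.update (config x x' y y') (.inr (.inl j)) t
      = config x (Function.update x' j t) y y' := by
  rw [config, Sum.update_elim_inr, Sum.update_elim_inl, config]

theorem update_config_y (x : Fin N → ℂ) (x' : Fin N' → ℂ) (y : Fin M → ℂ) (y' : Fin M' → ℂ)
    (j : Fin M) (t : ℂ) : Function.update (config x x' y y') (.inr (.inr (.inl j))) t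
      = config x x' (Function.update y j t) y' := by
  rw [config, Sum.update_elim_inr, Sum.update_elim_inr, Sum.update_elim_inl, config]

theorem update_config_y' (x : Fin N → ℂ) (x' : Fin N' → ℂ) (y : Fin M → ℂ) (y' : Fin M' → ℂ)
    (j : Fin M') (t : ℂ) : Function.update (config x x' y y') (.inr (.inr (.inr j))) t
      = config x x' y (Function.update y' j t) := by
  rw [config, Sum.update_elim_inr, Sum.update_elim_inr, Sum.update_elim_inr, config]

theorem sum_offDiag_eq {n : ℕ} (β : ℝ) (a : ℂ) (x : Fin n → ℂ) :
    ∑ j, ∑ k, a * (if j = k then 0 else V β (x j - x k))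
      = 2 * ∑ j, ∑ k ∈ Finset.Ioi j, a * V β (x j - x k) := by
  have h1 : ∀ j k : Fin n, a * (if j = k then 0 else V β (x j - x k))
      = (if j < k then a * V β (x j - x k) else 0) + (if k < j then a * V β (x k - x j) else 0) := by
    intro j k
    rcases lt_trichotomy j k with h | h | h
    · simp [h, h.ne, h.not_gt]
    · simp [h]
    · rw [← V_neg β (x k - x j), neg_sub]
      simp [h, h.ne', h.not_gt]
  have h2 : ∀ j : Fin n, ∑ k ∈ Finset.Ioi j, a * V β (x j - x k)
      = ∑ k, if j < k then a * V β (x j - x k) else 0 := by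
    intro j
    rw [← Finset.sum_filter]
    congr 1
    ext k
    simp
  have h3 : ∑ j : Fin n, ∑ k, (if k < j then a * V β (x k - x j) else 0)
      = ∑ j : Fin n, ∑ k, (if j < k then a * V β (x j - x k) else 0) := Finset.sum_comm
  simp only [h1, h2, Finset.sum_add_distrib]
  rw [h3]
  ring

theorem sum_cross_symm {n n' : ℕ} (β : ℝ) (a : ℂ) (x : Fin n → ℂ) (z : Fin n' → ℂ) :
    ∑ J, ∑ j, a * V β (z J - x j) = ∑ j, ∑ J, a * V β (x j - z J) := by
  rw [Finset.sum_comm]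
  refine Finset.sum_congr rfl fun j _ => Finset.sum_congr rfl fun J _ => ?_
  rw [← V_neg β (z J - x j), neg_sub]

/-- The couplings reproduce `H` on `(x, x̃)` and `-H` on `(y, ỹ)`. The mixed ones vanish, through
opposite charges for `(x, y)` and `(x̃, ỹ)` and through charge product `1/λ` for the others. The
factor `1/2` compensates for ordered pairs. -/
theorem potential_eq {lam : ℂ} (hlam : lam ≠ 0) (β : ℝ) (x : Fin N → ℂ) (x' : Fin N' → ℂ)
    (y : Fin M → ℂ) (y' : Fin M' → ℂ) :
    1 / 2 * ∑ J : Particle N N' M M', ∑ K : Particle N N' M M',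
        (-lam * (charge lam J + charge lam K) * (1 - lam * (charge lam J * charge lam K)))
          * pairValue (V β) (config x x' y y') J K
      = (∑ j : Fin N, ∑ k ∈ Finset.Ioi j, 2 * lam * (lam - 1) * V β (x j - x k))
        + (∑ J : Fin N', ∑ K ∈ Finset.Ioi J, 2 * (lam - 1) / lam * V β (x' J - x' K))
        + (∑ j : Fin N, ∑ K : Fin N', 2 * (1 - lam) * V β (x j - x' K))
        - ((∑ j : Fin M, ∑ k ∈ Finset.Ioi j, 2 * lam * (lam - 1) * V β (y j - y k))
        + (∑ J : Fin M', ∑ K ∈ Finset.Ioi J, 2 * (lam - 1) / lam * V β (y' J - y' K))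
        + (∑ j : Fin M, ∑ K : Fin M', 2 * (1 - lam) * V β (y j - y' K))) := by
  have g11 : -lam * (1 + 1) * (1 - lam * (1 * 1)) = 2 * lam * (lam - 1) := by ring
  have g12 : -lam * (1 + -1 / lam) * (1 - lam * (1 * (-1 / lam))) = 2 * (1 - lam) := by
    field_simp; ring
  have g21 : -lam * (-1 / lam + 1) * (1 - lam * (-1 / lam * 1)) = 2 * (1 - lam) := by
    field_simp; ring
  have g13 : -lam * (1 + -1) * (1 - lam * (1 * -1)) = 0 := by ring
  have g31 : -lam * (-1 + 1) * (1 - lam * (-1 * 1)) = 0 := by ring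
  have g14 : -lam * (1 + 1 / lam) * (1 - lam * (1 * (1 / lam))) = 0 := by field_simp; ring
  have g41 : -lam * (1 / lam + 1) * (1 - lam * (1 / lam * 1)) = 0 := by field_simp; ring
  have g22 : -lam * (-1 / lam + -1 / lam) * (1 - lam * (-1 / lam * (-1 / lam)))
      = 2 * (lam - 1) / lam := by field_simp; ring
  have g23 : -lam * (-1 / lam + -1) * (1 - lam * (-1 / lam * -1)) = 0 := by field_simp; ring
  have g32 : -lam * (-1 + -1 / lam) * (1 - lam * (-1 * (-1 / lam))) = 0 := by field_simp; ring
  have g24 : -lam * (-1 / lam + 1 / lam) * (1 - lam * (-1 / lam * (1 / lam))) = 0 := by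
    field_simp; ring
  have g42 : -lam * (1 / lam + -1 / lam) * (1 - lam * (1 / lam * (-1 / lam))) = 0 := by
    field_simp; ring
  have g33 : -lam * (-1 + -1) * (1 - lam * (-1 * -1)) = -(2 * lam * (lam - 1)) := by ring
  have g34 : -lam * (-1 + 1 / lam) * (1 - lam * (-1 * (1 / lam))) = -(2 * (1 - lam)) := by
    field_simp; ring
  have g43 : -lam * (1 / lam + -1) * (1 - lam * (1 / lam * -1)) = -(2 * (1 - lam)) := by
    field_simp; ring
  have g44 : -lam * (1 / lam + 1 / lam) * (1 - lam * (1 / lam * (1 / lam)))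
      = -(2 * (lam - 1) / lam) := by field_simp; ring
  simp only [Fintype.sum_sum_type, charge, pairValue, config, Sum.elim_inl, Sum.elim_inr,
    Sum.inl.injEq, Sum.inr.injEq, reduceCtorEq, if_false, Finset.sum_add_distrib,
    g11, g12, g13, g14, g21, g22, g23, g24, g31, g32, g33, g34, g41, g42, g43, g44, zero_mul,
    Finset.sum_const_zero, add_zero, zero_add, sum_offDiag_eq, sum_cross_symm β _ x x',
    sum_cross_symm β _ y y']
  simp only [neg_mul, Finset.sum_neg_distrib]
  ring

theorem sum_charge_pow (lam : ℂ) (n : ℕ) :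
    ∑ J : Particle N N' M M', charge lam J ^ n
      = N + N' * (-1 / lam) ^ n + M * (-1) ^ n + M' * (1 / lam) ^ n := by
  simp only [Fintype.sum_sum_type, charge, Finset.sum_const, Finset.card_univ, Fintype.card_fin,
    nsmul_eq_mul, one_pow, mul_one]
  ring

theorem sourceConst_charge {lam : ℂ} (hlam : lam ≠ 0) (β : ℝ) :
    sourceConst (charge lam : Particle N N' M M' → ℂ) lam β = C lam β N M N' M' := by
  have h1 := sum_charge_pow (N := N) (N' := N') (M := M) (M' := M') lam 1
  simp only [pow_one] at h1
  rw [sourceConst, C, h1, sum_charge_pow, sum_charge_pow]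
  field_simp
  ring

theorem analyticAt_config {f : (Particle N N' M M' → ℂ) → ℂ} {x : Fin N → ℂ} {x' : Fin N' → ℂ}
    {y : Fin M → ℂ} {y' : Fin M' → ℂ} (hf : AnalyticAt ℂ f (config x x' y y')) :
    AnalyticAt ℂ (fun p : (Fin N → ℂ) × (Fin N' → ℂ) × (Fin M → ℂ) × (Fin M' → ℂ) =>
      f (config p.1 p.2.1 p.2.2.1 p.2.2.2)) (x, x', y, y') := by
  have hproj : ∀ {κ : Type} [Fintype κ] (i : κ) (z : κ → ℂ),
      AnalyticAt ℂ (fun z : κ → ℂ => z i) z := fun i z =>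
    (ContinuousLinearMap.proj (R := ℂ) (φ := fun _ => ℂ) i).analyticAt z
  refine AnalyticAt.fun_comp (g := f) hf ?_
  rw [analyticAt_pi_iff]
  rintro (j | j | j | j)
  · exact AnalyticAt.fun_comp (hproj j _) analyticAt_fst
  · exact AnalyticAt.fun_comp (hproj j _) (analyticAt_fst.fun_comp analyticAt_snd)
  · exact AnalyticAt.fun_comp (hproj j _)
      (analyticAt_fst.fun_comp (analyticAt_snd.fun_comp analyticAt_snd))
  · exact AnalyticAt.fun_comp (hproj j _)
      (analyticAt_snd.fun_comp (analyticAt_snd.fun_comp analyticAt_snd))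

end

end EllipticCS

end

/-! ### The identity for the four species -/

theorem lemma1 (N N' M M' : ℕ) (lam : ℂ) (hlam : lam ≠ 0) (v : ℝ) (c : ℂ) (hc : c ≠ 0)
    (D : Set (ℂ × ℝ)) (L : ℂ × ℝ → ℂ) (hL : EllipticCS.IsLogThetaBranch D L)
    (β : ℝ) (hβ : 0 < β)
    (x : Fin N → ℂ) (x' : Fin N' → ℂ) (y : Fin M → ℂ) (y' : Fin M' → ℂ)
    (hadm : EllipticCS.Admissible D β x x' y y') :
    AnalyticAt ℂ
      (fun p : (Fin N → ℂ) × (Fin N' → ℂ) × (Fin M → ℂ) × (Fin M' → ℂ) =>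
        EllipticCS.boostedF L lam c v β p.1 p.2.1 p.2.2.1 p.2.2.2) (x, x', y, y') ∧
    DifferentiableAt ℝ (fun b : ℝ => EllipticCS.boostedF L lam c v b x x' y y') β ∧
    EllipticCS.H lam β N N' (fun z z' => EllipticCS.boostedF L lam c v β z z' y y') x x'
      - EllipticCS.H lam β M M' (fun z z' => EllipticCS.boostedF L lam c v β x x' z z') y y'
      + 2 * (((N : ℂ) - M) * lam - N' + M')
          * deriv (fun b : ℝ => EllipticCS.boostedF L lam c v b x x' y y') β
      - (EllipticCS.C lam β N M N' M' + ((N : ℂ) - M - ((N' : ℂ) - M') / lam) * (v : ℂ) ^ 2)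
          * EllipticCS.boostedF L lam c v β x x' y y' = 0 := by
  have hk := EllipticCS.isLocalPower_pairKernel hL lam hβ hadm
  have hana := EllipticCS.analyticAt_sourceFun (m := EllipticCS.charge lam) (w := Complex.I * v)
    (c := c) fun J K => (hk J K).1
  obtain ⟨Gd, -, hGd⟩ := EllipticCS.differentiableAt_sourceFun_param (m := EllipticCS.charge lam)
    (w := Complex.I * v) (c := c) hk
  have hE := EllipticCS.sourceExpr_eq_zero (m := EllipticCS.charge lam) (lam := lam)
    (w := Complex.I * v) (c := c) hβ (EllipticCS.charge_ne_zero hlam)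
    (EllipticCS.pairKernel_self L lam) (EllipticCS.pairExponent_add hlam)
    (EllipticCS.pairExponent_self lam) hk
    (EllipticCS.coupling_eq_zero_or_theta_ne_zero hL hlam hadm)
  have hp1 := EllipticCS.sum_charge_pow (N := N) (N' := N') (M := M) (M' := M') lam 1
  simp only [pow_one] at hp1
  rw [EllipticCS.sourceExpr, EllipticCS.potential_eq hlam, EllipticCS.sourceConst_charge hlam,
    hp1] at hE
  simp only [Fintype.sum_sum_type, EllipticCS.secondPartial, EllipticCS.update_config_x,
    EllipticCS.update_config_x', EllipticCS.update_config_y, EllipticCS.update_config_y',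
    ← EllipticCS.boostedF_eq_sourceFun, EllipticCS.charge, ← Finset.mul_sum] at hE
  simp only [EllipticCS.config, Sum.elim_inl, Sum.elim_inr] at hE
  refine ⟨?_, ?_, ?_⟩
  · simp only [EllipticCS.boostedF_eq_sourceFun]
    exact EllipticCS.analyticAt_config hana
  · simp only [EllipticCS.boostedF_eq_sourceFun]
    exact hGd.self_of_nhds.differentiableAt
  · simp only [EllipticCS.H, EllipticCS.partial2, ← Finset.mul_sum]
    generalize EllipticCS.boostedF L lam c v β x x' y y' = G at hE ⊢
    generalize deriv (fun b : ℝ => EllipticCS.boostedF L lam c v b x x' y y') β = Gb at hE ⊢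
    rw [← hE]
    -- The plane wave enters with `w = iv`, so `-w²` supplies `+v²`. The quotients below are the
    -- kinetic coefficients `-1/m` of the two tilded species, and `e3` is `2λ` times the total
    -- charge.
    have hI : (Complex.I * (v : ℂ)) ^ 2 = -(v : ℂ) ^ 2 := by rw [mul_pow, Complex.I_sq]; ring
    have e1 : (-1 : ℂ) / (-1 / lam) = lam := by field_simp
    have e2 : (-1 : ℂ) / (1 / lam) = -lam := by field_simp
    have e3 : 2 * lam * ((N : ℂ) + N' * (-1 / lam) + M * (-1) + M' * (1 / lam))
        = 2 * (((N : ℂ) - M) * lam - N' + M') := by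
      field_simp
      ring
    rw [hI, e1, e2, e3]
    ring
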